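/- Let $f\colon(\mathbb{C}^2,0)\to(\mathbb{C},0)$ be the germ of an analytic function, with expansion $f=f_m+f_{m+1}+\cdots$ into homogeneous polynomials $f_k$ of degree $k$, and assume that $f$ is mini-regular in $x$ of order $m$, that is, $f_m(1,0)\neq 0$. A Puiseux series means here a series $\varphi(y)=\sum_{n\ge 1}a_n y^{n/N}$ with $N\ge 1$ an integer and $\sum_n a_nt^n$ convergent near $t=0$ (possibly $\varphi=0$). A Newton–Puiseux root of an analytic germ $h$ is a Puiseux series $\varphi$ with $h(\varphi(y),y)=0$. Let $\Gamma(f)$ be the set of Newton–Puiseux roots of $\partial f/\partial x$ that are not Newton–Puiseux roots of $f$, and let $\mathcal{Q}(f)=\{\mathrm{ord}\, f(\gamma(y),y) : \gamma\in\Gamma(f)\}$ be the set of polar quotients of $f$, where $\mathrm{ord}$ is the order in $y$, a rational number for a nonzero series. Let $\xi_1,\dots,\xi_r$ be the distinct Newton–Puiseux roots of $f$ and assume $r\ge 2$. For $i<j$ let $\rho=\mathrm{ord}(\xi_i-\xi_j)$ be the contact order of $\xi_i=\sum_\alpha a_\alpha y^{\alpha}$ and $\xi_j$, and let $$\xi_{i,j}(y)=\sum_{\alpha<\rho}a_\alpha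 y^{\alpha}+g\,y^{\rho},\qquad g\in\mathbb{C}\text{ generic},$$ be their approximation. Then, for each $i<j$, the order of $f(\xi_{i,j}(y),y)$ is finite and the same for all but finitely many $g\in\mathbb{C}$; denoting this generic value by $\mathrm{ord}\, f(\xi_{i,j}(y),y)$, we have $$\mathcal{Q}(f)=\{\mathrm{ord}\, f(\xi_{i,j}(y),y) : 1\le i<j\le r\}.$$ -/

import Mathlib

open Filter Topology

namespace PlaneGerm

noncomputable section

/-! ### Germs of analytic functions of two variables `(x, y)`

A germ at the origin is represented by a function `f : ℂ × ℂ → ℂ` that is analytic at `0`; every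
notion below depends only on the values of `f` near `0`. -/

/-- The homogeneous part `f_k` of degree `k` in the Taylor expansion of `f` at the origin. -/
def homogeneousPart (f : ℂ × ℂ → ℂ) (k : ℕ) (v : ℂ × ℂ) : ℂ :=
  ((k.factorial : ℂ))⁻¹ * iteratedFDeriv ℂ k f 0 (fun _ => v)

/-- `f = f_m + f_{m+1} + ⋯` with `f_m(1, 0) ≠ 0`. -/
def IsMiniRegularInX (f : ℂ × ℂ → ℂ) (m : ℕ) : Prop :=
  (∀ k < m, ∀ v, homogeneousPart f k v = 0) ∧ homogeneousPart f m (1, 0) ≠ 0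

/-- The partial derivative `∂f/∂x`. -/
def partialX (f : ℂ × ℂ → ℂ) : ℂ × ℂ → ℂ :=
  fun p => deriv (fun x => f (x, p.2)) p.1

/-! ### Convergent Puiseux series

Formal series in `y` with rational exponents are elements of `HahnSeries ℚ ℂ`. -/

/-- `φ` is a convergent power series in `y^{1/N}` without constant term. -/
def IsPuiseuxOfDenom (N : ℕ) (φ : HahnSeries ℚ ℂ) : Prop :=
  0 < N ∧ (∀ q : ℚ, φ.coeff q ≠ 0 → ∃ n : ℕ, 0 < n ∧ q = (n : ℚ) / N) ∧
    ∃ R : ℝ, 0 < R ∧ Summable fun n : ℕ => ‖φ.coeff ((n : ℚ) / N)‖ * R ^ n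

/-- `φ` is a (convergent) Puiseux series with positive exponents; `φ = 0` is allowed. -/
def IsPuiseux (φ : HahnSeries ℚ ℂ) : Prop :=
  ∃ N : ℕ, IsPuiseuxOfDenom N φ

/-- The least `N` such that `φ` is a convergent power series in `y^{1/N}`. -/
def denom (φ : HahnSeries ℚ ℂ) : ℕ :=
  sInf {N : ℕ | IsPuiseuxOfDenom N φ}

/-- The function `t ↦ φ(t^N)`, for `φ` a convergent power series in `y^{1/N}`. -/
def param (φ : HahnSeries ℚ ℂ) (N : ℕ) (t : ℂ) : ℂ :=
  ∑' n : ℕ, φ.coeff ((n : ℚ) / N) * t ^ n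

/-- The function `t ↦ f(φ(t^N), t^N)`, that is, `f(φ(y), y)` in the variable `t = y^{1/N}`. -/
def pullback (f : ℂ × ℂ → ℂ) (φ : HahnSeries ℚ ℂ) (N : ℕ) (t : ℂ) : ℂ :=
  f (param φ N t, t ^ N)

/-- The order in `y` of `f(φ(y), y)`: the order of vanishing in `t = y^{1/N}`, divided by `N`;
it is `⊤` exactly if `f(φ(y), y)` vanishes identically. It does not depend on the choice of an
admissible `N`, see `ordAlong_eq`. -/
def ordAlong (f : ℂ × ℂ → ℂ) (φ : HahnSeries ℚ ℂ) : WithTop ℚ :=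
  WithTop.map (fun n : ℕ => (n : ℚ) / (denom φ : ℚ)) (analyticOrderAt (pullback f φ (denom φ)) 0)

/-- `φ` is a Newton–Puiseux root of `f = 0`: a Puiseux series with `f(φ(y), y) = 0`. -/
def IsNewtonPuiseuxRoot (f : ℂ × ℂ → ℂ) (φ : HahnSeries ℚ ℂ) : Prop :=
  IsPuiseux φ ∧ ∀ᶠ t in 𝓝 (0 : ℂ), pullback f φ (denom φ) t = 0

/-- `Γ(f)`: the Newton–Puiseux roots of `∂f/∂x = 0` that are not roots of `f = 0`. -/
def polarBranches (f : ℂ × ℂ → ℂ) : Set (HahnSeries ℚ ℂ) :=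
  {γ | IsNewtonPuiseuxRoot (partialX f) γ ∧ ¬ IsNewtonPuiseuxRoot f γ}

/-- `Q(f)`: the polar quotients of `f`. -/
def polarQuotients (f : ℂ × ℂ → ℂ) : Set (WithTop ℚ) :=
  {q | ∃ γ ∈ polarBranches f, q = ordAlong f γ}

/-! ### Approximations -/

/-- The `ρ`-approximation of `φ` with constant `g`: the terms of `φ` of exponent `< ρ`, plus
`g y^ρ`. -/
def rhoApprox (φ : HahnSeries ℚ ℂ) (ρ : ℚ) (g : ℂ) : HahnSeries ℚ ℂ :=
  HahnSeries.truncLT ρ φ + HahnSeries.single ρ g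

/-- The contact order of two distinct series. -/
def contactOrder (φ ψ : HahnSeries ℚ ℂ) : ℚ := (φ - ψ).order

/-- The approximation of two distinct series, with constant `g`. -/
def approx (φ ψ : HahnSeries ℚ ℂ) (g : ℂ) : HahnSeries ℚ ℂ :=
  rhoApprox φ (contactOrder φ ψ) g

/-- `q` is the order of `f` along the approximation of `φ` and `ψ` with generic constant: it is
the order for all but finitely many values of the constant. -/
def IsGenericOrd (f : ℂ × ℂ → ℂ) (φ ψ : HahnSeries ℚ ℂ) (q : WithTop ℚ) : Prop :=
  ∀ᶠ g : ℂ in cofinite, ordAlong f (approx φ ψ g) = q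

/-! ### Independence of the denominator -/

theorem IsPuiseuxOfDenom.analyticAt_param {N : ℕ} {φ : HahnSeries ℚ ℂ}
    (h : IsPuiseuxOfDenom N φ) : AnalyticAt ℂ (param φ N) 0 := by
  obtain ⟨hN, hs, R, hR, hsum⟩ := h
  have hd : DifferentiableOn ℂ (param φ N) (Metric.ball 0 R) := by
    apply Complex.differentiableOn_tsum_of_summable_norm hsum
    · intro i; fun_prop
    · exact Metric.isOpen_ball
    · intro i w hw
      rw [norm_mul, norm_pow]
      have : ‖w‖ ≤ R := by simpa using (Metric.mem_ball.1 hw).le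
      gcongr
  exact hd.analyticAt (Metric.ball_mem_nhds 0 hR)

theorem IsPuiseuxOfDenom.param_zero {N : ℕ} {φ : HahnSeries ℚ ℂ}
    (h : IsPuiseuxOfDenom N φ) : param φ N 0 = 0 := by
  obtain ⟨hN, hs, -⟩ := h
  have h0 : φ.coeff 0 = 0 := by
    by_contra hc
    obtain ⟨n, hn, hq⟩ := hs 0 hc
    have : (0 : ℚ) < (n : ℚ) / N := by positivity
    exact this.ne hq
  unfold param
  convert tsum_zero with n
  rcases Nat.eq_zero_or_pos n with rfl | hn
  · simp [h0]
  · simp [hn.ne']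

theorem IsPuiseuxOfDenom.param_mul {N k : ℕ} (hk : 0 < k) {φ : HahnSeries ℚ ℂ}
    (h : IsPuiseuxOfDenom N φ) (t : ℂ) : param φ (N * k) t = param φ N (t ^ k) := by
  obtain ⟨hN, hs, -⟩ := h
  unfold param
  have hinj : Function.Injective (fun n : ℕ => n * k) := fun a b hab =>
    Nat.eq_of_mul_eq_mul_right hk hab
  have hk' : (k : ℚ) ≠ 0 := by positivity
  have hN' : (N : ℚ) ≠ 0 := by positivity
  rw [← hinj.tsum_eq]
  · refine tsum_congr fun n => ?_
    have : ((n * k : ℕ) : ℚ) / ((N * k : ℕ) : ℚ) = (n : ℚ) / N := by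
      push_cast; field_simp
    simp only [this]
    rw [← pow_mul, mul_comm k n]
  · intro n hn
    have hc : φ.coeff ((n : ℚ) / ((N * k : ℕ) : ℚ)) ≠ 0 := fun hc => hn (by simp only [hc, zero_mul])
    obtain ⟨l, -, hl⟩ := hs _ hc
    refine ⟨l, ?_⟩
    push_cast at hl
    field_simp at hl
    have : (n : ℚ) = ((l * k : ℕ) : ℚ) := by push_cast; linarith
    exact_mod_cast this.symm

theorem analyticAt_pullback {f : ℂ × ℂ → ℂ} (hf : AnalyticAt ℂ f 0) {N : ℕ}
    {φ : HahnSeries ℚ ℂ} (h : IsPuiseuxOfDenom N φ) : AnalyticAt ℂ (pullback f φ N) 0 := by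
  have h2 : AnalyticAt ℂ (fun t : ℂ => (param φ N t, t ^ N)) 0 :=
    h.analyticAt_param.prod (by fun_prop)
  have h0 : ((fun t : ℂ => (param φ N t, t ^ N)) 0) = 0 := by
    simp [h.param_zero, h.1.ne']
  exact AnalyticAt.comp (g := f) (h0 ▸ hf :) h2

theorem order_pullback_mul {f : ℂ × ℂ → ℂ} (hf : AnalyticAt ℂ f 0) {N k : ℕ} (hk : 0 < k)
    {φ : HahnSeries ℚ ℂ} (h : IsPuiseuxOfDenom N φ) :
    analyticOrderAt (pullback f φ (N * k)) 0 = analyticOrderAt (pullback f φ N) 0 * k := by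
  have he : pullback f φ (N * k) = pullback f φ N ∘ fun t => t ^ k := by
    funext t
    simp only [pullback, Function.comp, h.param_mul hk, ← pow_mul, mul_comm k N]
  have h0 : (0 : ℂ) ^ k = 0 := zero_pow hk.ne'
  have hg : AnalyticAt ℂ (fun t : ℂ => t ^ k) 0 := by fun_prop
  have hA := analyticAt_pullback hf h
  rw [he, AnalyticAt.analyticOrderAt_comp (by simpa only [h0] using hA) hg]
  simp only [h0, sub_zero]
  congr 1
  have h3 := analyticOrderAt_pow (𝕜 := ℂ) (f := id) (z₀ := 0) analyticAt_id k
  rw [analyticOrderAt_id, nsmul_eq_mul, mul_one] at h3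
  exact h3

theorem ordAlong_eq {f : ℂ × ℂ → ℂ} (hf : AnalyticAt ℂ f 0) {N : ℕ} {φ : HahnSeries ℚ ℂ}
    (h : IsPuiseuxOfDenom N φ) :
    ordAlong f φ =
      WithTop.map (fun n : ℕ => (n : ℚ) / (N : ℚ)) (analyticOrderAt (pullback f φ N) 0) := by
  have hM : IsPuiseuxOfDenom (denom φ) φ := Nat.sInf_mem (s := {N | IsPuiseuxOfDenom N φ}) ⟨N, h⟩
  unfold ordAlong
  generalize denom φ = M at hM
  have h1 := order_pullback_mul hf h.1 hM
  have h2 := order_pullback_mul hf hM.1 h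
  rw [mul_comm N M, h1] at h2
  have hM0 : (M : ℚ) ≠ 0 := by exact_mod_cast hM.1.ne'
  have hN0 : (N : ℚ) ≠ 0 := by exact_mod_cast h.1.ne'
  have hM1 : (M : ℕ∞) ≠ 0 := by exact_mod_cast hM.1.ne'
  have hN1 : (N : ℕ∞) ≠ 0 := by exact_mod_cast h.1.ne'
  generalize analyticOrderAt (pullback f φ M) 0 = a at h2 ⊢
  generalize analyticOrderAt (pullback f φ N) 0 = b at h2 ⊢
  induction a using ENat.recTopCoe with
  | top =>
    induction b using ENat.recTopCoe with
    | top => rfl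
    | coe b =>
      rw [ENat.top_mul hN1] at h2
      exact absurd h2.symm (by exact_mod_cast ENat.natCast_ne_top (b * M))
  | coe a =>
    induction b using ENat.recTopCoe with
    | top =>
      rw [ENat.top_mul hM1] at h2
      exact absurd h2 (by exact_mod_cast ENat.natCast_ne_top (a * N))
    | coe b =>
      have h3 : a * N = b * M := by exact_mod_cast h2
      have h4 : (a : ℚ) * N = b * M := by exact_mod_cast h3
      change (((a : ℚ) / M : ℚ) : WithTop ℚ) = (((b : ℚ) / N : ℚ) : WithTop ℚ)
      congr 1
      rw [div_eq_div_iff hM0 hN0]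
      exact h4

end

end PlaneGerm

namespace PlaneGerm

noncomputable section

/-! ### Division by a coordinate -/

/-! Everything is read off one Newton polygon at a time. Along a Puiseux series φ in t = y^(1/N),
write f(φ + z t^σ, t^N) = t^M H(z, t) with P(z) = H(z, 0) a nonzero polynomial (`IsRescaling`). A
series φ + (a + ⋯) t^σ gives f the order M/N as soon as P(a) ≠ 0; hence M/N is the generic order at
exponent σ/N. Roots of f of this form have P(a) = 0. Conversely, roots of P lift to roots of f, and
roots of P' that are not roots of P lift to polar branches, because H and ∂H/∂z again have
convergent Puiseux roots (`exists_puiseux_root`).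

From roots to polar quotients (`exists_polarBranch_of_roots`): if two roots of f have contact σ/N,
then P has two distinct roots, so P' has a root where P does not vanish (`exists_derivative_root`).
Its lift is a polar branch of order M/N.

From polar quotients to roots (`exists_roots_of_polarBranch`): expand f along a polar branch γ. The
coefficient of x vanishes and the constant one does not. The side of the Newton polygon leaving the
vertex of the constant term gives P with P(0) ≠ 0, P'(0) = 0 and P not constant. Such a P has two
distinct roots (`exists_two_roots`); they lift to roots of f whose contact is exactly the exponent
of that side, and P(0) ≠ 0 shows that f has the generic order along γ. -/

/-- The power series is integrated term by term; since `‖D s‖ ≤ 1`, its coefficients do not grow and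
the radius survives. It serves the contractions (x, y) ↦ (s x, y) in Hadamard's lemma. -/
theorem analyticAt_integral_comp_clm {E : Type*} [NormedAddCommGroup E] [NormedSpace ℂ E]
    {F : E → ℂ} (hF : AnalyticAt ℂ F 0) {D : ℝ → E →L[ℂ] E} (hD : Continuous D)
    (hD1 : ∀ s ∈ Set.Icc (0 : ℝ) 1, ‖D s‖ ≤ 1) :
    AnalyticAt ℂ (fun p => ∫ s in (0 : ℝ)..1, F (D s p)) 0 := by
  obtain ⟨p, r, hp⟩ := hF
  let A : ∀ n, ℝ → ContinuousMultilinearMap ℂ (fun _ : Fin n => E) ℂ :=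
    fun n s => (p n).compContinuousLinearMap fun _ => D s
  have hA : ∀ n, Continuous (A n) := fun n => by
    have h := (ContinuousMultilinearMap.compContinuousLinearMapContinuousMultilinear ℂ
      (fun _ : Fin n => E) (fun _ : Fin n => E) ℂ).cont.comp
        (continuous_pi fun _ : Fin n => hD)
    exact (ContinuousLinearMap.apply ℂ _ (p n)).continuous.comp h
  have hu : Set.uIoc (0 : ℝ) 1 ⊆ Set.Icc 0 1 := by
    rw [Set.uIoc_of_le zero_le_one]; exact Set.Ioc_subset_Icc_self
  have hAn : ∀ n, ∀ s ∈ Set.Icc (0 : ℝ) 1, ‖A n s‖ ≤ ‖p n‖ := fun n s hs => by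
    refine (ContinuousMultilinearMap.norm_compContinuousLinearMap_le _ _).trans ?_
    refine mul_le_of_le_one_right (norm_nonneg _) ?_
    exact Finset.prod_le_one (fun _ _ => norm_nonneg _) fun _ _ => hD1 s hs
  let q : FormalMultilinearSeries ℂ E ℂ := fun n => ∫ s in (0 : ℝ)..1, A n s
  have hq : ∀ n, ‖q n‖ ≤ ‖p n‖ := fun n => by
    have := intervalIntegral.norm_integral_le_of_norm_le_const (a := 0) (b := 1) (f := A n)
      (C := ‖p n‖) fun s hs => hAn n s (hu hs)
    simpa using this
  refine ⟨q, r, ⟨hp.r_le.trans ?_, hp.r_pos, ?_⟩⟩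
  · refine ENNReal.le_of_forall_nnreal_lt fun s hs => ?_
    obtain ⟨C, -, hC⟩ := p.norm_mul_pow_le_of_lt_radius hs
    exact q.le_radius_of_bound C fun n =>
      (mul_le_mul_of_nonneg_right (hq n) (by positivity)).trans (hC n)
  · intro y hy
    have hyr : (‖y‖₊ : ENNReal) < p.radius := by
      refine lt_of_lt_of_le ?_ hp.r_le
      simpa [edist_zero_right, enorm_eq_nnnorm] using hy
    have hsum : Summable fun n => ‖p n‖ * ‖y‖ ^ n := by
      have := p.summable_norm_mul_pow (r := ‖y‖₊) hyr
      simpa only [coe_nnnorm] using this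
    have key := intervalIntegral.hasSum_integral_of_dominated_convergence
      (μ := MeasureTheory.volume) (a := 0) (b := 1)
      (F := fun n s => A n s fun _ => y) (f := fun s => F (D s (0 + y)))
      (fun n _ => ‖p n‖ * ‖y‖ ^ n) ?_ ?_ ?_ ?_ ?_
    · convert key using 2 with n
      exact (ContinuousLinearMap.intervalIntegral_comp_comm
        (ContinuousMultilinearMap.apply ℂ (fun _ : Fin n => E) ℂ fun _ => y)
        ((hA n).intervalIntegrable 0 1)).symm
    · intro n
      exact ((ContinuousMultilinearMap.apply ℂ (fun _ : Fin n => E) ℂ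
        fun _ => y).continuous.comp (hA n)).aestronglyMeasurable
    · intro n
      refine .of_forall fun s hs => ((A n s).le_opNorm _).trans ?_
      simp only [Finset.prod_const, Finset.card_univ, Fintype.card_fin]
      exact mul_le_mul_of_nonneg_right (hAn n s (hu hs)) (by positivity)
    · exact .of_forall fun s _ => hsum
    · exact intervalIntegrable_const
    · refine .of_forall fun s hs => ?_
      have hys : D s y ∈ Metric.eball (0 : E) r := by
        have h1 : ‖D s y‖ ≤ ‖y‖ := by
          simpa using (D s).le_of_opNorm_le (hD1 s (hu hs)) y
        have hy' : ‖y‖ₑ < r := by simpa [edist_zero_right] using hy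
        have : ‖D s y‖ₑ ≤ ‖y‖ₑ := by
          simpa [enorm_eq_nnnorm] using (show ‖D s y‖₊ ≤ ‖y‖₊ from h1)
        simpa [edist_zero_right] using this.trans_lt hy'
      simpa [A] using hp.hasSum hys

theorem hasDerivAt_fderiv_apply_fst {f : ℂ × ℂ → ℂ} {p : ℂ × ℂ} (hf : AnalyticAt ℂ f p) :
    HasDerivAt (fun x => f (x, p.2)) (fderiv ℂ f p (1, 0)) p.1 := by
  have h1 : HasFDerivAt f (fderiv ℂ f p) (p.1, p.2) := hf.differentiableAt.hasFDerivAt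
  have h2 : HasDerivAt (fun x : ℂ => (x, p.2)) ((1 : ℂ), (0 : ℂ)) p.1 :=
    (hasDerivAt_id p.1).prodMk (hasDerivAt_const _ _)
  exact h1.comp_hasDerivAt p.1 h2

theorem hasDerivAt_partialX {f : ℂ × ℂ → ℂ} {p : ℂ × ℂ} (hf : AnalyticAt ℂ f p) :
    HasDerivAt (fun x => f (x, p.2)) (partialX f p) p.1 :=
  (hasDerivAt_fderiv_apply_fst hf).differentiableAt.hasDerivAt

theorem analyticAt_partialX {f : ℂ × ℂ → ℂ} {p : ℂ × ℂ} (hf : AnalyticAt ℂ f p) :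
    AnalyticAt ℂ (partialX f) p := by
  have h : AnalyticAt ℂ (fun q => fderiv ℂ f q (1, 0)) p :=
    ((ContinuousLinearMap.apply ℂ ℂ ((1 : ℂ), (0 : ℂ))).analyticAt _).comp hf.fderiv
  refine h.congr ?_
  filter_upwards [hf.eventually_analyticAt] with q hq
  exact (hasDerivAt_fderiv_apply_fst hq).deriv.symm

/-- Hadamard's lemma for analytic germs in two variables. -/
theorem exists_eq_add_fst_mul {h : ℂ × ℂ → ℂ} (hh : AnalyticAt ℂ h 0) :
    ∃ h' : ℂ × ℂ → ℂ, AnalyticAt ℂ h' 0 ∧ ∀ᶠ p in 𝓝 (0 : ℂ × ℂ), h p = h (0, p.2) + p.1 * h' p := by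
  let D : ℝ → ℂ × ℂ →L[ℂ] ℂ × ℂ := fun s =>
    ((s : ℂ) • ContinuousLinearMap.fst ℂ ℂ ℂ).prod (ContinuousLinearMap.snd ℂ ℂ ℂ)
  have hDapp : ∀ s p, D s p = ((s : ℂ) * p.1, p.2) := fun s p => by simp [D]
  have hD : Continuous D := by
    have : Continuous fun s : ℝ => (((s : ℂ) • ContinuousLinearMap.fst ℂ ℂ ℂ,
        ContinuousLinearMap.snd ℂ ℂ ℂ) : (ℂ × ℂ →L[ℂ] ℂ) × (ℂ × ℂ →L[ℂ] ℂ)) := by fun_prop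
    exact (ContinuousLinearMap.prodₗᵢ (𝕜 := ℂ) (E := ℂ × ℂ) (F := ℂ) (G := ℂ) ℂ).continuous.comp this
  have hbound : ∀ s ∈ Set.Icc (0 : ℝ) 1, ∀ p : ℂ × ℂ, ‖D s p‖ ≤ ‖p‖ := fun s hs p => by
    rw [hDapp]
    refine max_le ?_ (norm_snd_le p)
    rw [norm_mul, Complex.norm_real, Real.norm_of_nonneg hs.1]
    exact (mul_le_of_le_one_left (norm_nonneg _) hs.2).trans (norm_fst_le p)
  -- The quotient is ∫₀¹ ∂ₓh(s x, y) ds, by the fundamental theorem of calculus in s.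
  refine ⟨_, analyticAt_integral_comp_clm (analyticAt_partialX hh) hD
    (fun s hs => (D s).opNorm_le_bound zero_le_one fun p => by simpa using hbound s hs p), ?_⟩
  obtain ⟨ε, hε, hball⟩ := Metric.eventually_nhds_iff_ball.1 hh.eventually_analyticAt
  filter_upwards [Metric.ball_mem_nhds 0 hε] with p hp
  have hmem : ∀ s ∈ Set.Icc (0 : ℝ) 1, AnalyticAt ℂ h (D s p) := fun s hs => by
    apply hball
    rw [mem_ball_zero_iff] at hp ⊢
    exact (hbound s hs p).trans_lt hp
  have hderiv : ∀ s ∈ Set.uIcc (0 : ℝ) 1,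
      HasDerivAt (fun s : ℝ => h ((s : ℂ) * p.1, p.2)) (p.1 * partialX h (D s p)) s := by
    intro s hs
    rw [Set.uIcc_of_le zero_le_one] at hs
    have h1 := hasDerivAt_partialX (hmem s hs)
    rw [hDapp] at h1 ⊢
    have h2 : HasDerivAt (fun s : ℂ => s * p.1) p.1 (s : ℂ) := by
      simpa using (hasDerivAt_id (s : ℂ)).mul_const p.1
    have h3 := (HasDerivAt.comp (s : ℂ) h1 h2).comp_ofReal
    rw [mul_comm]
    exact h3
  have hcont : ContinuousOn (fun s : ℝ => p.1 * partialX h (D s p)) (Set.uIcc 0 1) := by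
    intro s hs
    rw [Set.uIcc_of_le zero_le_one] at hs
    have h1 := (analyticAt_partialX (hmem s hs)).continuousAt
    have h2 : Continuous fun s => D s p := hD.clm_apply continuous_const
    exact (continuousAt_const.mul (ContinuousAt.comp (f := fun s => D s p) h1
      h2.continuousAt)).continuousWithinAt
  have := intervalIntegral.integral_eq_sub_of_hasDerivAt hderiv hcont.intervalIntegrable
  rw [intervalIntegral.integral_const_mul] at this
  rw [this]
  simp

/-- `h = ∑_{k<d} c_k(y) x^k + x^d U(x, y)` near the origin, with analytic coefficients. -/
structure HasExpansion (h : ℂ × ℂ → ℂ) (d : ℕ) (c : ℕ → ℂ → ℂ) (U : ℂ × ℂ → ℂ) : Prop where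
  analyticAt_coeff : ∀ k, AnalyticAt ℂ (c k) 0
  analyticAt_rem : AnalyticAt ℂ U 0
  eventually_eq : ∀ᶠ p in 𝓝 (0 : ℂ × ℂ),
    h p = ∑ k ∈ Finset.range d, c k p.2 * p.1 ^ k + p.1 ^ d * U p

theorem exists_hasExpansion {h : ℂ × ℂ → ℂ} (hh : AnalyticAt ℂ h 0) (d : ℕ) :
    ∃ c U, HasExpansion h d c U := by
  induction d with
  | zero => exact ⟨fun _ _ => 0, h, fun _ => analyticAt_const, hh, by simp⟩
  | succ d ih =>
    obtain ⟨c, U, hc⟩ := ih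
    obtain ⟨V, hV, hUV⟩ := exists_eq_add_fst_mul hc.analyticAt_rem
    refine ⟨Function.update c d fun t => U (0, t), V, fun k => ?_, hV, ?_⟩
    · rcases eq_or_ne k d with rfl | hk
      · rw [Function.update_self]
        exact AnalyticAt.fun_comp (f := fun t : ℂ => ((0 : ℂ), t)) hc.analyticAt_rem (by fun_prop)
      · rw [Function.update_of_ne hk]
        exact hc.analyticAt_coeff k
    · filter_upwards [hc.eventually_eq, hUV] with p h1 h2
      rw [h1, h2, Finset.sum_range_succ, Function.update_self]
      have : ∀ k ∈ Finset.range d, Function.update c d (fun t => U (0, t)) k p.2 * p.1 ^ k =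
          c k p.2 * p.1 ^ k := fun k hk => by
        rw [Function.update_of_ne (Finset.mem_range.1 hk).ne]
      rw [Finset.sum_congr rfl this]
      ring

theorem analyticOrderAt_pow_zero (n : ℕ) : analyticOrderAt (fun x : ℂ => x ^ n) 0 = n := by
  have := analyticOrderAt_centeredMonomial (𝕜 := ℂ) (z₀ := 0) (n := n)
  simp only [sub_zero] at this
  exact this

/-! ### Comparison with derivatives -/

theorem iteratedDeriv_of_eq_sum_add {F w : ℂ → ℂ} (hF : AnalyticAt ℂ F 0) {d : ℕ} {a : ℕ → ℂ}
    (hw : AnalyticAt ℂ w 0)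
    (h : ∀ᶠ x in 𝓝 (0 : ℂ), F x = ∑ k ∈ Finset.range d, a k * x ^ k + x ^ d * w x)
    {k : ℕ} (hk : k < d) : iteratedDeriv k F 0 = k.factorial * a k := by
  have hS : AnalyticAt ℂ (fun x : ℂ => ∑ k ∈ Finset.range d, a k * x ^ k) 0 := by fun_prop
  have h1 : (d : ℕ∞) ≤ analyticOrderAt (F - fun x => ∑ k ∈ Finset.range d, a k * x ^ k) 0 := by
    rw [natCast_le_analyticOrderAt (hF.sub hS)]
    refine ⟨w, hw, ?_⟩
    filter_upwards [h] with x hx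
    simp [hx]
  rw [natCast_le_analyticOrderAt_iff_iteratedDeriv_eq_zero (hF.sub hS)] at h1
  have h2 := h1 k hk
  rw [iteratedDeriv_sub hF.contDiffAt hS.contDiffAt, sub_eq_zero] at h2
  rw [h2, iteratedDeriv_fun_sum (fun i _ => by fun_prop), Finset.sum_eq_single k]
  · rw [iteratedDeriv_const_mul_field, iteratedDeriv_fun_pow_zero, if_pos rfl, mul_comm]
  · intro i _ hi
    rw [iteratedDeriv_const_mul_field, iteratedDeriv_fun_pow_zero, if_neg hi.symm, Nat.cast_zero, mul_zero]
  · intro hk'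
    exact absurd (Finset.mem_range.2 hk) hk'

theorem HasExpansion.iteratedDeriv_eq {h : ℂ × ℂ → ℂ} {d : ℕ} {c : ℕ → ℂ → ℂ} {U : ℂ × ℂ → ℂ}
    (hE : HasExpansion h d c U) (hh : AnalyticAt ℂ h 0) :
    ∀ᶠ t in 𝓝 (0 : ℂ), ∀ k < d, iteratedDeriv k (fun x => h (x, t)) 0 = k.factorial * c k t := by
  have hc : Tendsto (fun t : ℂ => ((0 : ℂ), t)) (𝓝 0) (𝓝 0) := by
    have : Continuous fun t : ℂ => ((0 : ℂ), t) := by fun_prop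
    exact this.tendsto' 0 0 rfl
  filter_upwards [hc.eventually hh.eventually_analyticAt,
    hc.eventually hE.analyticAt_rem.eventually_analyticAt,
    hc.eventually hE.eventually_eq.eventually_nhds] with t h1 h2 h3 k hk
  have hx : Tendsto (fun x : ℂ => (x, t)) (𝓝 0) (𝓝 (0, t)) := by
    have : Continuous fun x : ℂ => (x, t) := by fun_prop
    exact this.tendsto' 0 (0, t) rfl
  have h4 : AnalyticAt ℂ (fun x : ℂ => h (x, t)) 0 :=
    AnalyticAt.fun_comp (f := fun x : ℂ => (x, t)) h1 (by fun_prop)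
  have h5 : AnalyticAt ℂ (fun x : ℂ => U (x, t)) 0 :=
    AnalyticAt.fun_comp (f := fun x : ℂ => (x, t)) h2 (by fun_prop)
  exact iteratedDeriv_of_eq_sum_add (a := fun k => c k t) h4 h5 (hx.eventually h3) hk

theorem analyticAt_section {h : ℂ × ℂ → ℂ} (hh : AnalyticAt ℂ h 0) :
    AnalyticAt ℂ (fun x => h (x, 0)) 0 :=
  AnalyticAt.fun_comp (f := fun x : ℂ => (x, (0 : ℂ))) hh (by fun_prop)

/-- This makes (d, 0) a vertex of the Newton polygon: x^d carries a unit, and all lower powers of x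
have coefficients vanishing at the origin. -/
theorem HasExpansion.of_order {h : ℂ × ℂ → ℂ} {d : ℕ} {c : ℕ → ℂ → ℂ} {U : ℂ × ℂ → ℂ}
    (hE : HasExpansion h d c U) (hh : AnalyticAt ℂ h 0)
    (hd : analyticOrderAt (fun x => h (x, 0)) 0 = d) : (∀ k < d, c k 0 = 0) ∧ U 0 ≠ 0 := by
  have h0 := analyticAt_section hh
  have hU := analyticAt_section hE.analyticAt_rem
  have hc : ∀ k < d, c k 0 = 0 := fun k hk => by
    have h1 := (hE.iteratedDeriv_eq hh).self_of_nhds k hk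
    have h2 := ((natCast_le_analyticOrderAt_iff_iteratedDeriv_eq_zero h0).1 hd.ge) k hk
    rw [h2] at h1
    simpa [Nat.factorial_ne_zero] using h1.symm
  refine ⟨hc, ?_⟩
  have hx : Tendsto (fun x : ℂ => (x, (0 : ℂ))) (𝓝 0) (𝓝 0) := by
    have : Continuous fun x : ℂ => (x, (0 : ℂ)) := by fun_prop
    exact this.tendsto' 0 0 rfl
  have he : (fun x => h (x, 0)) =ᶠ[𝓝 0] (fun x => x ^ d) * fun x => U (x, 0) := by
    filter_upwards [hx.eventually hE.eventually_eq] with x hx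
    rw [hx, Finset.sum_eq_zero fun k hk => by rw [hc k (Finset.mem_range.1 hk), zero_mul]]
    simp
  rw [analyticOrderAt_congr he, analyticOrderAt_mul (by fun_prop) hU] at hd
  rw [analyticOrderAt_pow_zero] at hd
  have h4 : analyticOrderAt (fun x => U (x, 0)) 0 = 0 := by
    generalize analyticOrderAt (fun x => U (x, 0)) 0 = a at hd
    induction a using ENat.recTopCoe with
    | top => simp at hd
    | coe a =>
      have : d + a = d := by exact_mod_cast hd
      simpa using this
  exact hU.analyticOrderAt_eq_zero.1 h4

/-! ### Rescaling -/

theorem analyticOrderAt_comp_pow {g : ℂ → ℂ} (hg : AnalyticAt ℂ g 0) {q : ℕ} (hq : 0 < q) :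
    analyticOrderAt (fun s => g (s ^ q)) 0 = analyticOrderAt g 0 * q := by
  have h0 : (0 : ℂ) ^ q = 0 := zero_pow hq.ne'
  have := AnalyticAt.analyticOrderAt_comp (f := g) (g := fun s : ℂ => s ^ q) (z₀ := 0)
    (by simpa only [h0] using hg) (by fun_prop)
  simpa only [Function.comp_def, h0, sub_zero, analyticOrderAt_pow_zero] using this

/-- `h(z y^σ, y) = y^M H(z, y)`, where `H(z, 0) = P(z)`. -/
structure IsRescaling (h : ℂ × ℂ → ℂ) (σ M : ℕ) (H : ℂ × ℂ → ℂ) (P : Polynomial ℂ) : Prop where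
  analyticAt : ∀ a, AnalyticAt ℂ H (a, 0)
  eval_eq : ∀ a, H (a, 0) = P.eval a
  eventually_eq : ∀ a, ∀ᶠ p in 𝓝 (a, (0 : ℂ)), h (p.1 * p.2 ^ σ, p.2) = p.2 ^ M * H p

/-- Give t^i x^k the weight i + kσ. If no weight is below M, then t^M factors out, and P collects
the terms of weight exactly M. The last two clauses say which points of the polygon lie on that
line. -/
theorem HasExpansion.exists_isRescaling {h : ℂ × ℂ → ℂ} {d : ℕ} {c : ℕ → ℂ → ℂ} {U : ℂ × ℂ → ℂ}
    (hE : HasExpansion h d c U) (hU : U 0 ≠ 0) {σ M : ℕ} (hσ : 0 < σ)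
    (hM : ∀ k < d, (M : ℕ∞) ≤ analyticOrderAt (c k) 0 + (k * σ : ℕ)) (hMd : M ≤ d * σ) :
    ∃ H P, IsRescaling h σ M H P ∧ P.natDegree ≤ d ∧
      (∀ k < d, P.coeff k ≠ 0 ↔ analyticOrderAt (c k) 0 + (k * σ : ℕ) = M) ∧
      (P.coeff d ≠ 0 ↔ d * σ = M) := by
  have hprod : ∀ k, AnalyticAt ℂ ((c k) * fun t : ℂ => t ^ (k * σ)) 0 := fun k =>
    (hE.analyticAt_coeff k).mul (by fun_prop)
  have hord : ∀ k, analyticOrderAt ((c k) * fun t : ℂ => t ^ (k * σ)) 0 =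
      analyticOrderAt (c k) 0 + (k * σ : ℕ) := fun k => by
    rw [analyticOrderAt_mul (hE.analyticAt_coeff k) (by fun_prop), analyticOrderAt_pow_zero]
  have hv : ∀ k, ∃ v : ℂ → ℂ, AnalyticAt ℂ v 0 ∧ (k < d →
      ∀ᶠ t in 𝓝 (0 : ℂ), c k t * t ^ (k * σ) = t ^ M * v t) := fun k => by
    by_cases hk : k < d
    · have h1 := hM k hk
      rw [← hord, natCast_le_analyticOrderAt (hprod k)] at h1
      obtain ⟨v, hv, he⟩ := h1
      exact ⟨v, hv, fun _ => by simpa using he⟩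
    · exact ⟨0, analyticAt_const, fun h => absurd h hk⟩
  choose v hv hve using hv
  -- With 0^0 = 1, this is `U 0` when `M = d * σ` and 0 otherwise.
  obtain ⟨u, hu⟩ : ∃ u, u = (0 : ℂ) ^ (d * σ - M) * U 0 := ⟨_, rfl⟩
  let P : Polynomial ℂ := ∑ k ∈ Finset.range d, Polynomial.C (v k 0) * Polynomial.X ^ k +
    Polynomial.C u * Polynomial.X ^ d
  let H : ℂ × ℂ → ℂ := fun p => ∑ k ∈ Finset.range d, v k p.2 * p.1 ^ k +
    p.2 ^ (d * σ - M) * U (p.1 * p.2 ^ σ, p.2) * p.1 ^ d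
  have hcoeff : ∀ k < d, P.coeff k = v k 0 := fun k hk => by
    simp [P, Polynomial.coeff_X_pow, hk.ne, hk]
  have hcoeffd : P.coeff d = u := by
    simp [P, Polynomial.coeff_X_pow]
  have h0 : ∀ a : ℂ, ((a * (0 : ℂ) ^ σ, (0 : ℂ)) : ℂ × ℂ) = 0 := fun a => by
    simp [hσ.ne']
  have hsnd : ∀ a : ℂ, Tendsto Prod.snd (𝓝 (a, (0 : ℂ))) (𝓝 0) := fun a =>
    continuous_snd.tendsto' _ _ rfl
  have hscale : ∀ a : ℂ, Tendsto (fun p : ℂ × ℂ => (p.1 * p.2 ^ σ, p.2)) (𝓝 (a, (0 : ℂ)))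
      (𝓝 0) := fun a => by
    have : Continuous fun p : ℂ × ℂ => (p.1 * p.2 ^ σ, p.2) := by fun_prop
    exact this.tendsto' _ _ (h0 a)
  refine ⟨H, P, ⟨fun a => ?_, fun a => ?_, fun a => ?_⟩, ?_, fun k hk => ?_, ?_⟩
  · have h1 : ∀ k, AnalyticAt ℂ (fun p : ℂ × ℂ => v k p.2) (a, 0) := fun k =>
      AnalyticAt.fun_comp (f := fun p : ℂ × ℂ => p.2) (hv k) analyticAt_snd
    have h2 : AnalyticAt ℂ (fun p : ℂ × ℂ => U (p.1 * p.2 ^ σ, p.2)) (a, 0) :=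
      AnalyticAt.fun_comp (f := fun p : ℂ × ℂ => (p.1 * p.2 ^ σ, p.2))
        (by simpa only [h0] using hE.analyticAt_rem)
        ((analyticAt_fst.mul (analyticAt_snd.pow σ)).prod analyticAt_snd)
    exact (Finset.analyticAt_fun_sum _ fun k _ => (h1 k).mul (analyticAt_fst.pow k)).add
      (((analyticAt_snd.pow _).mul h2).mul (analyticAt_fst.pow d))
  · simp only [H, h0]
    simp [P, Polynomial.eval_finsetSum, hu]
  · have h1 : ∀ᶠ t in 𝓝 (0 : ℂ), ∀ k ∈ Finset.range d, c k t * t ^ (k * σ) = t ^ M * v k t :=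
      (Filter.eventually_all_finset _).2 fun k hk => hve k (Finset.mem_range.1 hk)
    filter_upwards [(hsnd a).eventually h1, (hscale a).eventually hE.eventually_eq] with p h1 h2
    rw [h2, mul_add, Finset.mul_sum]
    congr 1
    · refine Finset.sum_congr rfl fun k hk => ?_
      rw [← mul_assoc, ← h1 k hk]
      ring
    · obtain ⟨e, he⟩ := Nat.exists_eq_add_of_le hMd
      rw [he, Nat.add_sub_cancel_left, mul_pow, ← pow_mul, mul_comm σ d, he]
      ring
  · refine Polynomial.natDegree_le_iff_coeff_eq_zero.2 fun n hn => ?_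
    simp [P, Polynomial.coeff_X_pow, hn.ne', hn.not_gt]
  · rw [hcoeff k hk, ← hord]
    have he : (c k) * (fun t : ℂ => t ^ (k * σ)) =ᶠ[𝓝 0] (fun t => t ^ M) * v k := by
      filter_upwards [hve k hk] with t ht using ht
    rw [analyticOrderAt_congr he, analyticOrderAt_mul (by fun_prop) (hv k),
      analyticOrderAt_pow_zero, ← (hv k).analyticOrderAt_eq_zero]
    generalize analyticOrderAt (v k) 0 = b
    induction b using ENat.recTopCoe with
    | top => simp
    | coe b => norm_cast; omega
  · rw [hcoeffd, hu]
    rcases hMd.eq_or_lt with h | h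
    · simp [h, hU]
    · simp [(Nat.sub_pos_of_lt h).ne', h.ne']

/-- Ramification, used to turn a rational slope into an integer `σ`. -/
theorem HasExpansion.comp_pow {h : ℂ × ℂ → ℂ} {d : ℕ} {c : ℕ → ℂ → ℂ} {U : ℂ × ℂ → ℂ}
    (hE : HasExpansion h d c U) {q : ℕ} (hq : 0 < q) :
    HasExpansion (fun p => h (p.1, p.2 ^ q)) d (fun k s => c k (s ^ q))
      (fun p => U (p.1, p.2 ^ q)) := by
  have h0 : (0 : ℂ) ^ q = 0 := zero_pow hq.ne'
  refine ⟨fun k => ?_, ?_, ?_⟩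
  · exact AnalyticAt.fun_comp (f := fun s : ℂ => s ^ q)
      (by simpa only [h0] using hE.analyticAt_coeff k) (by fun_prop)
  · refine AnalyticAt.fun_comp (f := fun p : ℂ × ℂ => (p.1, p.2 ^ q)) ?_
      (analyticAt_fst.prod (analyticAt_snd.pow q))
    have : ((0 : ℂ × ℂ).1, (0 : ℂ × ℂ).2 ^ q) = 0 := by simp [h0]
    rw [this]
    exact hE.analyticAt_rem
  · have : Continuous fun p : ℂ × ℂ => (p.1, p.2 ^ q) := by fun_prop
    exact (this.tendsto' 0 0 (by simp [h0])).eventually hE.eventually_eq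

/-! ### Complex polynomials -/

open Polynomial in
theorem eq_C_mul_X_sub_C_pow {P : ℂ[X]} {a : ℂ} (h : ∀ b, P.IsRoot b → b = a) :
    P = C P.leadingCoeff * (X - C a) ^ P.natDegree := by
  have h1 := (IsAlgClosed.splits P).eq_prod_roots
  have h2 : P.roots = Multiset.replicate P.natDegree a := by
    rw [(IsAlgClosed.splits P).natDegree_eq_card_roots, Multiset.eq_replicate_card]
    exact fun b hb => h b (isRoot_of_mem_roots hb)
  rw [h2] at h1
  simpa using h1

open Polynomial in
-- Otherwise P = c (X - a)^d. The missing term of degree d - 1 forces a = 0, and then P = c X^d has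
-- no term of degree k.
theorem exists_root_rootMultiplicity_lt {P : ℂ[X]} {d k : ℕ} (hd : P.natDegree ≤ d)
    (hd0 : P.coeff d ≠ 0) (hd1 : P.coeff (d - 1) = 0) (hk : k < d) (hk0 : P.coeff k ≠ 0) :
    ∃ a, P.IsRoot a ∧ P.rootMultiplicity a < d := by
  have hdeg : P.natDegree = d := le_antisymm hd (le_natDegree_of_ne_zero hd0)
  have hP : P ≠ 0 := by rintro rfl; simp at hd0
  obtain ⟨a, ha⟩ := IsAlgClosed.exists_root P (by
    rw [degree_eq_natDegree hP, hdeg]; exact_mod_cast (by omega : d ≠ 0))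
  by_contra! hcon
  have hall : ∀ b, P.IsRoot b → b = a := fun b hb => by
    by_contra hab
    have h1 := hcon a ha
    have h2 := hcon b hb
    have h3 : ({a, b} : Finset ℂ).sum (fun x => P.rootMultiplicity x) ≤ Multiset.card P.roots := by
      rw [← Multiset.toFinset_sum_count_eq]
      simp only [count_roots]
      refine Finset.sum_le_sum_of_subset fun x hx => ?_
      rw [Multiset.mem_toFinset, mem_roots hP]
      rcases Finset.mem_insert.1 hx with rfl | hx
      · exact ha
      · rwa [Finset.mem_singleton.1 hx]
    rw [Finset.sum_pair (Ne.symm hab)] at h3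
    have := P.card_roots'
    omega
  have heq := eq_C_mul_X_sub_C_pow hall
  rw [hdeg] at heq
  have hl : P.leadingCoeff ≠ 0 := leadingCoeff_ne_zero.2 hP
  have hcd : P.coeff (d - 1) = P.leadingCoeff * (-(d * a)) := by
    conv_lhs => rw [heq]
    obtain ⟨e, rfl⟩ : ∃ e, d = e + 1 := ⟨d - 1, by omega⟩
    rw [coeff_C_mul, sub_eq_add_neg, ← C_neg, coeff_X_add_C_pow, Nat.add_sub_cancel,
      Nat.add_sub_cancel_left, Nat.choose_succ_self_right, pow_one]
    push_cast
    ring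
  rw [hd1] at hcd
  have ha0 : a = 0 := by
    have hd' : (d : ℂ) ≠ 0 := by exact_mod_cast (by omega : d ≠ 0)
    simpa [hl, hd'] using hcd.symm
  apply hk0
  rw [heq, ha0]
  simp [coeff_X_pow, hk.ne]

open Polynomial in
-- With a single root, P = c (X - a)^n where a ≠ 0 and n > 0, so P'(0) ≠ 0.
theorem exists_two_roots {P : ℂ[X]} (h0 : P.coeff 0 ≠ 0) (h1 : P.coeff 1 = 0) {k : ℕ} (hk : 0 < k)
    (hk0 : P.coeff k ≠ 0) : ∃ a b, a ≠ b ∧ P.IsRoot a ∧ P.IsRoot b := by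
  have hP : P ≠ 0 := by rintro rfl; simp at h0
  have hdeg : 0 < P.natDegree := hk.trans_le (le_natDegree_of_ne_zero hk0)
  obtain ⟨a, ha⟩ := IsAlgClosed.exists_root P (by
    rw [degree_eq_natDegree hP]; exact_mod_cast hdeg.ne')
  by_contra! hcon
  have heq := eq_C_mul_X_sub_C_pow (a := a) fun b hb => by
    by_contra hab
    exact hcon a b (Ne.symm hab) ha hb
  have hl : P.leadingCoeff ≠ 0 := leadingCoeff_ne_zero.2 hP
  have ha0 : a ≠ 0 := by
    rintro rfl
    exact h0 (by rw [coeff_zero_eq_eval_zero]; exact ha)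
  have hd : (derivative P).eval 0 = 0 := by
    rw [← coeff_zero_eq_eval_zero, coeff_derivative, zero_add, h1, zero_mul]
  rw [heq] at hd
  simp [derivative_X_sub_C_pow, hl, ha0, hdeg.ne'] at hd

open Polynomial in
-- The r distinct roots of P account for only deg P - r roots of P', counted with multiplicity, and
-- r ≥ 2 makes this less than deg P - 1 = deg P'.
theorem exists_derivative_root {P : ℂ[X]} (hP : P ≠ 0) {a b : ℂ} (hab : a ≠ b) (ha : P.IsRoot a)
    (hb : P.IsRoot b) : ∃ c, (derivative P).IsRoot c ∧ ¬ P.IsRoot c := by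
  by_contra! hcon
  have h5 : 2 ≤ P.roots.toFinset.card := by
    rw [← Finset.card_pair hab]
    refine Finset.card_le_card fun x hx => ?_
    rw [Multiset.mem_toFinset, mem_roots hP]
    rcases Finset.mem_insert.1 hx with rfl | hx
    · exact ha
    · rwa [Finset.mem_singleton.1 hx]
  have hdeg : 0 < P.natDegree := by
    have := P.roots.toFinset_card_le
    have := P.card_roots'
    omega
  have hP' : derivative P ≠ 0 := fun h => by
    have := derivative_eq_zero.1 h
    omega
  have h1 : ∀ x ∈ P.roots.toFinset,
      (derivative P).rootMultiplicity x + 1 = P.rootMultiplicity x := fun x hx => by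
    have hx : P.IsRoot x := isRoot_of_mem_roots (Multiset.mem_toFinset.1 hx)
    have h2 := derivative_rootMultiplicity_of_root hx
    have h3 := (rootMultiplicity_pos hP).2 hx
    omega
  have h2 : Multiset.card (derivative P).roots = (derivative P).natDegree :=
    ((IsAlgClosed.splits _).natDegree_eq_card_roots).symm
  have h3 : Multiset.card P.roots = P.natDegree :=
    ((IsAlgClosed.splits _).natDegree_eq_card_roots).symm
  rw [← Multiset.toFinset_sum_count_eq] at h2 h3
  simp only [count_roots] at h2 h3
  have h4 : ∑ x ∈ (derivative P).roots.toFinset, (derivative P).rootMultiplicity x ≤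
      ∑ x ∈ P.roots.toFinset, (derivative P).rootMultiplicity x := by
    refine Finset.sum_le_sum_of_subset fun x hx => ?_
    rw [Multiset.mem_toFinset, mem_roots hP] 
    exact hcon x (isRoot_of_mem_roots (Multiset.mem_toFinset.1 hx))
  rw [← Finset.sum_congr rfl h1, Finset.sum_add_distrib] at h3
  have h6 := natDegree_eq_of_degree_eq_some (degree_derivative hdeg.ne')
  simp only [Finset.sum_const, smul_eq_mul, mul_one] at h3
  omega

/-! ### Existence of convergent Puiseux roots -/

theorem exists_analytic_root_of_partialX_ne_zero {D : ℂ × ℂ → ℂ} (hD : AnalyticAt ℂ D 0)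
    (hD0 : D 0 = 0) (hD1 : partialX D 0 ≠ 0) :
    ∃ ψ : ℂ → ℂ, AnalyticAt ℂ ψ 0 ∧ ψ 0 = 0 ∧ ∀ᶠ t in 𝓝 (0 : ℂ), D (ψ t, t) = 0 := by
  -- The coordinates are swapped because `implicitFunction` solves for the second one.
  let E : ℂ × ℂ → ℂ := fun p => D (p.2, p.1)
  have hE : AnalyticAt ℂ E 0 :=
    AnalyticAt.fun_comp (f := fun p : ℂ × ℂ => (p.2, p.1)) hD (analyticAt_snd.prod analyticAt_fst)
  have hcd : ContDiffAt ℂ ⊤ E 0 := hE.contDiffAt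
  have h1 : fderiv ℂ E 0 (0, 1) = partialX D 0 := by
    have h2 : HasDerivAt (fun x : ℂ => ((0 : ℂ), x)) ((0 : ℂ), (1 : ℂ)) 0 :=
      (hasDerivAt_const _ _).prodMk (hasDerivAt_id _)
    have h3 : HasFDerivAt E (fderiv ℂ E 0) ((0 : ℂ), (0 : ℂ)) := hE.differentiableAt.hasFDerivAt
    have h4 := h3.comp_hasDerivAt (0 : ℂ) h2
    exact h4.unique (hasDerivAt_partialX hD)
  have hinv : (fderiv ℂ E 0 ∘L .inr ℂ ℂ ℂ).IsInvertible := by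
    refine ⟨ContinuousLinearEquiv.unitsEquivAut ℂ (Units.mk0 _ hD1), ?_⟩
    ext
    simp [h1]
  refine ⟨hcd.implicitFunction (by simp) hinv, ?_, ?_, ?_⟩
  · exact (hcd.contDiffAt_implicitFunction (by simp) hinv).analyticAt
  · exact hcd.implicitFunction_apply_self (by simp) hinv
  · have := hcd.eventually_apply_implicitFunction (by simp) hinv
    filter_upwards [this] with t ht
    have h0 : E 0 = 0 := hD0
    rw [h0] at ht
    exact ht

theorem iterate_partialX_apply (f : ℂ × ℂ → ℂ) (k : ℕ) (p : ℂ × ℂ) :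
    (partialX^[k] f) p = iteratedDeriv k (fun x => f (x, p.2)) p.1 := by
  induction k generalizing p with
  | zero => simp
  | succ k ih =>
    rw [Function.iterate_succ_apply', iteratedDeriv_succ]
    unfold partialX
    congr 1
    funext x
    exact ih (x, p.2)

theorem analyticAt_iterate_partialX {f : ℂ × ℂ → ℂ} {p : ℂ × ℂ} (hf : AnalyticAt ℂ f p) (k : ℕ) :
    AnalyticAt ℂ (partialX^[k] f) p := by
  induction k with
  | zero => exact hf
  | succ k ih =>
    rw [Function.iterate_succ_apply']
    exact analyticAt_partialX ih

theorem analyticAt_shift {f : ℂ × ℂ → ℂ} (hf : AnalyticAt ℂ f 0) {g : ℂ → ℂ}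
    (hg : AnalyticAt ℂ g 0) (hg0 : g 0 = 0) {N : ℕ} (hN : 0 < N) :
    AnalyticAt ℂ (fun p : ℂ × ℂ => f (g p.2 + p.1, p.2 ^ N)) 0 := by
  have h1 : AnalyticAt ℂ (fun p : ℂ × ℂ => g p.2) 0 :=
    AnalyticAt.fun_comp (f := fun p : ℂ × ℂ => p.2) hg analyticAt_snd
  have h2 := (h1.add analyticAt_fst).prod ((analyticAt_snd (𝕜 := ℂ) (E := ℂ) (F := ℂ)
    (p := (0 : ℂ × ℂ))).pow N)
  refine AnalyticAt.fun_comp (f := fun p : ℂ × ℂ => (g p.2 + p.1, p.2 ^ N)) ?_ h2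
  have : ((g (0 : ℂ × ℂ).2 + (0 : ℂ × ℂ).1, (0 : ℂ × ℂ).2 ^ N) : ℂ × ℂ) = 0 := by
    simp [hg0, hN.ne']
  rw [this]
  exact hf

theorem analyticOrderAt_eval_add {P : Polynomial ℂ} (hP : P ≠ 0) (a : ℂ) :
    analyticOrderAt (fun z => P.eval (a + z)) 0 = P.rootMultiplicity a := by
  obtain ⟨Q, hQ, hQd⟩ := Polynomial.exists_eq_pow_rootMultiplicity_mul_and_not_dvd P hP a
  have hA : AnalyticAt ℂ (fun z => Q.eval (a + z)) 0 := by
    have : Differentiable ℂ fun z => Q.eval (a + z) := by fun_prop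
    exact this.analyticAt 0
  have hPA : AnalyticAt ℂ (fun z => P.eval (a + z)) 0 := by
    have : Differentiable ℂ fun z => P.eval (a + z) := by fun_prop
    exact this.analyticAt 0
  rw [hPA.analyticOrderAt_eq_natCast]
  refine ⟨_, hA, ?_, .of_forall fun z => ?_⟩
  · rw [Polynomial.dvd_iff_isRoot] at hQd
    simpa using hQd
  · conv_lhs => rw [hQ]
    simp

/-- A finite family of natural numbers has a minimal slope towards the point `(d, 0)`. -/
theorem exists_minimal_slope {d : ℕ} (e : ℕ → ℕ∞) {k₁ : ℕ} (hk₁ : k₁ < d) (h : e k₁ ≠ ⊤) :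
    ∃ k₀ < d, ∃ s : ℕ, e k₀ = s ∧
      ∀ k < d, ((s * (d - k) : ℕ) : ℕ∞) ≤ e k * (d - k₀ : ℕ) := by
  classical
  let S := (Finset.range d).filter fun k => e k ≠ ⊤
  obtain ⟨k₀, hk₀, hmin⟩ := S.exists_min_image (fun k => ((e k).toNat : ℚ) / (d - k : ℕ))
    ⟨k₁, by simp [S, hk₁, h]⟩
  simp only [S, Finset.mem_filter, Finset.mem_range] at hk₀ hmin
  refine ⟨k₀, hk₀.1, (e k₀).toNat, (ENat.natCast_toNat hk₀.2).symm, fun k hk => ?_⟩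
  have hpos : 0 < d - k₀ := by omega
  have hpos' : 0 < d - k := by omega
  by_cases hkt : e k = ⊤
  · rw [hkt, ENat.top_mul (by exact_mod_cast hpos.ne')]
    exact le_top
  · have := hmin k ⟨hk, hkt⟩
    rw [div_le_div_iff₀ (by exact_mod_cast hpos) (by exact_mod_cast hpos')] at this
    rw [← ENat.natCast_toNat hkt]
    exact_mod_cast this

theorem IsRescaling.analyticAt_shift {h : ℂ × ℂ → ℂ} {σ M : ℕ} {H : ℂ × ℂ → ℂ} {P : Polynomial ℂ}
    (hH : IsRescaling h σ M H P) (a : ℂ) : AnalyticAt ℂ (fun p : ℂ × ℂ => H (a + p.1, p.2)) 0 := by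
  refine AnalyticAt.fun_comp (f := fun p : ℂ × ℂ => (a + p.1, p.2)) ?_
    ((analyticAt_const.add analyticAt_fst).prod analyticAt_snd)
  simpa using hH.analyticAt a

/-- Newton–Puiseux by induction on d. The translation removes the coefficient of x^(d-1), so the
polynomial of the side ending at (d, 0) is not a d-th power of a linear form; rescaling at a root of
multiplicity below d lowers the order. Convergence needs no estimates, as finitely many analytic
substitutions are composed. -/
theorem exists_puiseux_root {d : ℕ} (hd : 0 < d) {G : ℂ × ℂ → ℂ} (hG : AnalyticAt ℂ G 0)
    (hord : analyticOrderAt (fun x => G (x, 0)) 0 = d) :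
    ∃ n : ℕ, 0 < n ∧ ∃ ψ : ℂ → ℂ, AnalyticAt ℂ ψ 0 ∧ ψ 0 = 0 ∧
      ∀ᶠ s in 𝓝 (0 : ℂ), G (ψ s, s ^ n) = 0 := by
  induction d using Nat.strong_induction_on generalizing G with
  | _ d ih =>
  have hsec := (analyticOrderAt_eq_nat_iff_iteratedDeriv_eq_zero (analyticAt_section hG)).1 hord
  -- solve `∂ᵈ⁻¹G/∂xᵈ⁻¹ = 0` and translate
  obtain ⟨ψ₀, hψ, hψ0, hψr⟩ := exists_analytic_root_of_partialX_ne_zero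
    (D := partialX^[d - 1] G) (analyticAt_iterate_partialX hG _)
    (by rw [iterate_partialX_apply]; exact hsec.1 _ (by omega))
    (by
      rw [← Function.iterate_succ_apply' partialX, iterate_partialX_apply,
        show (d - 1).succ = d by omega]
      exact hsec.2)
  let h : ℂ × ℂ → ℂ := fun p => G (ψ₀ p.2 + p.1, p.2 ^ 1)
  have hh : AnalyticAt ℂ h 0 := analyticAt_shift hG hψ hψ0 one_pos
  obtain ⟨c, U, hE⟩ := exists_hasExpansion hh d
  have hhord : analyticOrderAt (fun x => h (x, 0)) 0 = d := by
    simpa [h, hψ0] using hord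
  obtain ⟨hc0, hU⟩ := hE.of_order hh hhord
  have hcd : ∀ᶠ t in 𝓝 (0 : ℂ), c (d - 1) t = 0 := by
    filter_upwards [hE.iteratedDeriv_eq hh, hψr] with t h1 h2
    have h3 := h1 (d - 1) (by omega)
    have h4 := iteratedDeriv_comp_const_add (d - 1) (fun x => G (x, t)) (ψ₀ t)
    rw [iterate_partialX_apply] at h2
    have h5 : iteratedDeriv (d - 1) (fun x => h (x, t)) 0 = 0 := by
      have h6 := congrFun h4 0
      simp only [add_zero] at h6
      simp only [h, pow_one]
      rw [h6]
      exact h2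
    rw [h5] at h3
    simpa [Nat.factorial_ne_zero] using h3.symm
  -- If the constant coefficient vanishes, the translation is itself the root; this includes d = 1,
  -- by `hcd`.
  by_cases hc : analyticOrderAt (c 0) 0 = ⊤
  · rw [analyticOrderAt_eq_top] at hc
    refine ⟨1, one_pos, ψ₀, hψ, hψ0, ?_⟩
    have ht : Tendsto (fun t : ℂ => ((0 : ℂ), t)) (𝓝 0) (𝓝 0) := by
      have : Continuous fun t : ℂ => ((0 : ℂ), t) := by fun_prop
      exact this.tendsto' 0 0 rfl
    filter_upwards [ht.eventually hE.eventually_eq, hc] with t h1 h2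
    have h3 : ∑ k ∈ Finset.range d, c k t * (0 : ℂ) ^ k = c 0 t := by
      rw [Finset.sum_eq_single 0]
      · simp
      · intro k _ hk; simp [hk]
      · intro h; exact absurd (Finset.mem_range.2 hd) h
    simp only [h3, h2, zero_pow hd.ne', zero_mul, add_zero, h] at h1
    exact h1
  · obtain ⟨k₀, hk₀, s, hs, hmin⟩ := exists_minimal_slope (fun k => analyticOrderAt (c k) 0) hd hc
    have hs0 : 0 < s := by
      have h1 : analyticOrderAt (c k₀) 0 ≠ 0 :=
        (hE.analyticAt_coeff k₀).analyticOrderAt_ne_zero.2 (hc0 k₀ hk₀)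
      rw [hs] at h1
      exact Nat.pos_of_ne_zero (by exact_mod_cast h1)
    -- The slope s / (d - k₀) becomes the integer s after ramification of order d - k₀, and x^d then
    -- has weight d * s.
    have hq : 0 < d - k₀ := by omega
    have hE' := hE.comp_pow hq
    have ho : ∀ k, analyticOrderAt (fun t => c k (t ^ (d - k₀))) 0 =
        analyticOrderAt (c k) 0 * (d - k₀ : ℕ) := fun k =>
      analyticOrderAt_comp_pow (hE.analyticAt_coeff k) hq
    obtain ⟨H, P, hH, hPd, hPk, hPd0⟩ := hE'.exists_isRescaling (σ := s) (M := d * s)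
      (by
        show U ((0 : ℂ), (0 : ℂ) ^ (d - k₀)) ≠ 0
        rw [zero_pow hq.ne']
        exact hU) hs0 (fun k hk => by
        rw [ho]
        have h1 : d * s = s * (d - k) + k * s := by
          obtain ⟨e, rfl⟩ := Nat.exists_eq_add_of_le hk.le
          rw [Nat.add_sub_cancel_left]; ring
        rw [h1, Nat.cast_add]
        gcongr
        exact hmin k hk) le_rfl
    have hPdne : P.coeff d ≠ 0 := hPd0.2 rfl
    have hP0 : P ≠ 0 := by rintro rfl; simp at hPdne
    obtain ⟨a, ha, hmult⟩ := exists_root_rootMultiplicity_lt hPd hPdne (k := k₀)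
      (by
        by_contra hne
        have h1 := (hPk _ (by omega)).1 hne
        rw [ho, analyticOrderAt_eq_top.2 hcd, ENat.top_mul (by exact_mod_cast hq.ne'), top_add] at h1
        exact absurd h1.symm (ENat.natCast_ne_top _)) hk₀
      ((hPk _ hk₀).2 (by
        rw [ho, hs]
        obtain ⟨e, rfl⟩ := Nat.exists_eq_add_of_le hk₀.le
        rw [Nat.add_sub_cancel_left]
        norm_cast
        ring))
    obtain ⟨n, hn, ψ, hψa, hψ0', hroot⟩ := ih (P.rootMultiplicity a) hmult
      ((Polynomial.rootMultiplicity_pos hP0).2 ha) (hH.analyticAt_shift a)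
      (by simp only [hH.eval_eq]; exact analyticOrderAt_eval_add hP0 a)
    have h0n : (0 : ℂ) ^ (n * (d - k₀)) = 0 := zero_pow (by positivity)
    refine ⟨n * (d - k₀), by positivity,
      fun w => ψ₀ (w ^ (n * (d - k₀))) + (a + ψ w) * w ^ (n * s), ?_, ?_, ?_⟩
    · have h1 : AnalyticAt ℂ (fun w : ℂ => ψ₀ (w ^ (n * (d - k₀)))) 0 :=
        AnalyticAt.fun_comp (f := fun w : ℂ => w ^ (n * (d - k₀))) (by rwa [h0n]) (by fun_prop)
      exact h1.add ((analyticAt_const.add hψa).mul (by fun_prop))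
    · have h0s : (0 : ℂ) ^ (n * s) = 0 := zero_pow (by positivity)
      simp [h0n, h0s, hψ0]
    · have hcont : ContinuousAt (fun w : ℂ => (a + ψ w, w ^ n)) 0 := by
        have := hψa.continuousAt
        fun_prop
      have ht : Tendsto (fun w : ℂ => (a + ψ w, w ^ n)) (𝓝 0) (𝓝 (a, 0)) := by
        have := hcont.tendsto
        simpa [hψ0', hn.ne'] using this
      filter_upwards [hroot, ht.eventually (hH.eventually_eq a)] with w h1 h2
      rw [h1, mul_zero] at h2
      simpa [h, ← pow_mul] using h2

/-! ### Taylor coefficients of the parametrization -/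

theorem hasFPowerSeriesAt_tsum {a : ℕ → ℂ} {R : ℝ} (hR : 0 < R)
    (ha : Summable fun n => ‖a n‖ * R ^ n) :
    HasFPowerSeriesAt (fun t => ∑' n, a n * t ^ n) (FormalMultilinearSeries.ofScalars ℂ a) 0 := by
  lift R to NNReal using hR.le
  refine ⟨R, ?_, by simpa using hR, ?_⟩
  · refine FormalMultilinearSeries.le_radius_of_summable _ ?_
    simpa only [FormalMultilinearSeries.ofScalars_norm] using ha
  · intro y hy
    have hy' : ‖y‖ ≤ R := by
      have : ‖y‖ < R := by simpa using hy
      exact this.le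
    have hs : Summable fun n => a n * y ^ n := by
      refine Summable.of_norm_bounded ha fun n => ?_
      rw [norm_mul, norm_pow]
      gcongr
    rw [zero_add]
    have he : (fun n => FormalMultilinearSeries.ofScalars ℂ a n fun _ => y) =
        fun n => a n * y ^ n := by
      funext n
      simp [mul_comm]
    rw [he]
    exact hs.hasSum

/-- Uniqueness of power series; it lets formal coefficients be recovered from the germ of the
parametrization. -/
theorem IsPuiseuxOfDenom.coeff_eq {N : ℕ} {φ : HahnSeries ℚ ℂ} (h : IsPuiseuxOfDenom N φ) (n : ℕ) :
    φ.coeff ((n : ℚ) / N) = iteratedDeriv n (param φ N) 0 / n.factorial := by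
  obtain ⟨R, hR, hs⟩ := h.2.2
  have h1 := hasFPowerSeriesAt_tsum hR hs
  have h2 := h.analyticAt_param.hasFPowerSeriesAt
  exact congrFun (FormalMultilinearSeries.ofScalars_series_injective (𝕜 := ℂ) (E := ℂ)
    (h1.eq_formalMultilinearSeries h2)) n

theorem IsPuiseuxOfDenom.mul {N k : ℕ} (hk : 0 < k) {φ : HahnSeries ℚ ℂ}
    (h : IsPuiseuxOfDenom N φ) : IsPuiseuxOfDenom (N * k) φ := by
  obtain ⟨hN, hs, R, hR, hsum⟩ := h
  have hN' : (N : ℚ) ≠ 0 := by positivity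
  have hk' : (k : ℚ) ≠ 0 := by positivity
  have hsupp : ∀ q : ℚ, φ.coeff q ≠ 0 → ∃ n : ℕ, 0 < n ∧ q = ((n * k : ℕ) : ℚ) / (N * k : ℕ) ∧
      q = (n : ℚ) / N := fun q hq => by
    obtain ⟨n, hn, rfl⟩ := hs q hq
    exact ⟨n, hn, by push_cast; field_simp, rfl⟩
  -- A radius r = min R 1 satisfies r^k ≤ R, so the old bound dominates the stretched series.
  have hmin : 0 < min R 1 := lt_min hR one_pos
  refine ⟨by positivity, fun q hq => ?_, min R 1, hmin, ?_⟩
  · obtain ⟨n, hn, h, -⟩ := hsupp q hq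
    exact ⟨n * k, by positivity, h⟩
  · have hinj : Function.Injective (fun n : ℕ => n * k) := fun a b hab =>
      Nat.eq_of_mul_eq_mul_right hk hab
    rw [← hinj.summable_iff]
    · refine Summable.of_nonneg_of_le
        (fun n => mul_nonneg (norm_nonneg _) (pow_nonneg hmin.le _)) (fun n => ?_) hsum
      have h1 : ((n * k : ℕ) : ℚ) / ((N * k : ℕ) : ℚ) = (n : ℚ) / N := by
        push_cast; field_simp
      simp only [Function.comp_apply, h1]
      gcongr
      rw [mul_comm n k, pow_mul]
      gcongr
      refine (pow_le_of_le_one (by positivity) (min_le_right _ _) hk.ne').trans (min_le_left _ _)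
    · intro n hn
      by_contra hne
      have hc : φ.coeff ((n : ℚ) / (N * k : ℕ)) ≠ 0 := fun hc => hne (by rw [hc]; simp)
      obtain ⟨l, -, hl, -⟩ := hsupp _ hc
      refine hn ⟨l, ?_⟩
      rw [div_left_inj' (by exact_mod_cast (by positivity : N * k ≠ 0))] at hl
      exact_mod_cast hl.symm

/-! ### Series with prescribed parametrization -/

theorem exists_isPuiseuxOfDenom_param_eq {N : ℕ} (hN : 0 < N) {ψ : ℂ → ℂ}
    (hψ : AnalyticAt ℂ ψ 0) (hψ0 : ψ 0 = 0) :
    ∃ φ : HahnSeries ℚ ℂ, IsPuiseuxOfDenom N φ ∧ param φ N =ᶠ[𝓝 0] ψ := by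
  have hN' : (0 : ℚ) < N := by exact_mod_cast hN
  let e : ℕ ↪o ℚ := OrderEmbedding.ofStrictMono (fun n : ℕ => (n : ℚ) / N) fun a b hab => by
    have : (a : ℚ) < b := by exact_mod_cast hab
    simp only
    gcongr
  let a : ℕ → ℂ := fun n => iteratedDeriv n ψ 0 / n.factorial
  let φ : HahnSeries ℚ ℂ :=
    HahnSeries.embDomain e (HahnSeries.toPowerSeries.symm (PowerSeries.mk a))
  have hcoeff : ∀ n : ℕ, φ.coeff ((n : ℚ) / N) = a n := fun n => by
    have : φ.coeff (e n) = a n := by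
      rw [HahnSeries.embDomain_coeff, HahnSeries.coeff_toPowerSeries_symm, PowerSeries.coeff_mk]
    exact this
  obtain ⟨r, hr⟩ := hψ.hasFPowerSeriesAt
  obtain ⟨R, hR0, hR⟩ := ENNReal.lt_iff_exists_nnreal_btwn.1 (hr.r_pos.trans_le hr.r_le)
  have hsum := FormalMultilinearSeries.summable_norm_mul_pow _ hR
  simp only [FormalMultilinearSeries.ofScalars_norm] at hsum
  refine ⟨φ, ⟨hN, fun q hq => ?_, R, by exact_mod_cast hR0, ?_⟩, ?_⟩
  · have hq' : q ∈ Set.range e := by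
      by_contra hq'
      exact hq (HahnSeries.embDomain_of_notMem_range hq')
    obtain ⟨n, rfl⟩ := hq'
    refine ⟨n, Nat.pos_of_ne_zero ?_, rfl⟩
    rintro rfl
    apply hq
    rw [show e 0 = ((0 : ℕ) : ℚ) / N from rfl, hcoeff]
    simp [a, hψ0]
  · simpa only [hcoeff] using hsum
  · filter_upwards [hr.hasFPowerSeriesAt.eventually_hasSum] with t ht
    simp only [param, hcoeff]
    rw [zero_add] at ht
    rw [← ht.tsum_eq]
    simp [a, mul_comm]

/-! ### Comparison of two series -/

/-- Agreement of the series below σ/N means divisibility of the difference of germs by t^σ. With its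
converse `coeff_of_param_eq_add`, this translates contact orders into rescaled coordinates z. -/
theorem IsPuiseuxOfDenom.exists_param_eq_add {N σ : ℕ} {φ φ' : HahnSeries ℚ ℂ}
    (h : IsPuiseuxOfDenom N φ) (h' : IsPuiseuxOfDenom N φ')
    (hlt : ∀ q < (σ : ℚ) / N, φ'.coeff q = φ.coeff q) :
    ∃ z : ℂ → ℂ, AnalyticAt ℂ z 0 ∧
      z 0 = φ'.coeff ((σ : ℚ) / N) - φ.coeff ((σ : ℚ) / N) ∧
      ∀ᶠ t in 𝓝 (0 : ℂ), param φ' N t = param φ N t + t ^ σ * z t := by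
  have hN : (0 : ℚ) < N := by exact_mod_cast h.1
  have hA := h'.analyticAt_param.sub h.analyticAt_param
  have hder : ∀ n : ℕ, iteratedDeriv n (param φ' N - param φ N) 0 =
      n.factorial * (φ'.coeff ((n : ℚ) / N) - φ.coeff ((n : ℚ) / N)) := fun n => by
    rw [iteratedDeriv_sub h'.analyticAt_param.contDiffAt h.analyticAt_param.contDiffAt,
      h.coeff_eq, h'.coeff_eq]
    have : (n.factorial : ℂ) ≠ 0 := by exact_mod_cast n.factorial_ne_zero
    field_simp
  obtain ⟨w, hw, he⟩ := hA.exists_eventuallyEq_sum_add_pow_mul (σ + 1)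
  refine ⟨fun t => (φ'.coeff ((σ : ℚ) / N) - φ.coeff ((σ : ℚ) / N)) + t * w t,
    analyticAt_const.add (analyticAt_id.mul hw), by simp, ?_⟩
  filter_upwards [he] with t ht
  rw [Finset.sum_range_succ, Finset.sum_eq_zero, hder] at ht
  · have : (σ.factorial : ℂ) ≠ 0 := by exact_mod_cast σ.factorial_ne_zero
    rw [Pi.sub_apply, sub_eq_iff_eq_add] at ht
    rw [ht]
    simp only [smul_eq_mul]
    field_simp
    ring
  · intro k hk
    have hk := Finset.mem_range.1 hk
    rw [hder, hlt, sub_self, mul_zero, smul_zero]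
    have : (k : ℚ) < σ := by exact_mod_cast hk
    gcongr

theorem IsPuiseuxOfDenom.coeff_of_param_eq_add {N σ : ℕ} {φ φ' : HahnSeries ℚ ℂ}
    (h : IsPuiseuxOfDenom N φ) (h' : IsPuiseuxOfDenom N φ') {z : ℂ → ℂ} (hz : AnalyticAt ℂ z 0)
    (he : ∀ᶠ t in 𝓝 (0 : ℂ), param φ' N t = param φ N t + t ^ σ * z t) :
    (∀ q < (σ : ℚ) / N, φ'.coeff q = φ.coeff q) ∧
      φ'.coeff ((σ : ℚ) / N) = φ.coeff ((σ : ℚ) / N) + z 0 := by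
  have hN : (0 : ℚ) < N := by exact_mod_cast h.1
  have hA := h'.analyticAt_param.sub h.analyticAt_param
  obtain ⟨w, hw, hzw⟩ := hz.exists_eventuallyEq_sum_add_pow_mul 1
  have hder : ∀ n < σ + 1, φ'.coeff ((n : ℚ) / N) - φ.coeff ((n : ℚ) / N) =
      if n = σ then z 0 else 0 := fun n hn => by
    have h1 := iteratedDeriv_of_eq_sum_add (d := σ + 1) (a := fun n => if n = σ then z 0 else 0)
      hA hw (by
        filter_upwards [he, hzw] with t h1 h2
        rw [Pi.sub_apply, h1, h2]
        simp
        ring) hn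
    rw [iteratedDeriv_sub h'.analyticAt_param.contDiffAt h.analyticAt_param.contDiffAt] at h1
    rw [h.coeff_eq, h'.coeff_eq, ← sub_div, h1]
    have : (n.factorial : ℂ) ≠ 0 := by exact_mod_cast n.factorial_ne_zero
    field_simp
  constructor
  · intro q hq
    by_cases hn : ∃ n : ℕ, q = (n : ℚ) / N
    · obtain ⟨n, rfl⟩ := hn
      have hnσ : n < σ := by
        rw [div_lt_div_iff_of_pos_right hN] at hq
        exact_mod_cast hq
      have := hder n (by omega)
      rw [if_neg hnσ.ne] at this
      exact sub_eq_zero.1 this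
    · have h0 : ∀ φ : HahnSeries ℚ ℂ, IsPuiseuxOfDenom N φ → φ.coeff q = 0 := fun φ hφ => by
        by_contra hc
        obtain ⟨n, -, h⟩ := hφ.2.1 q hc
        exact hn ⟨n, h⟩
      rw [h0 _ h, h0 _ h']
  · have := hder σ (by omega)
    rw [if_pos rfl] at this
    rw [← this]; ring

theorem coeff_rhoApprox_of_lt {φ : HahnSeries ℚ ℂ} {ρ q : ℚ} (g : ℂ) (hq : q < ρ) :
    (rhoApprox φ ρ g).coeff q = φ.coeff q := by
  rw [rhoApprox, HahnSeries.coeff_add, HahnSeries.coeff_truncLT_of_lt hq,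
    HahnSeries.coeff_single_of_ne hq.ne, add_zero]

theorem coeff_rhoApprox_of_gt {φ : HahnSeries ℚ ℂ} {ρ q : ℚ} (g : ℂ) (hq : ρ < q) :
    (rhoApprox φ ρ g).coeff q = 0 := by
  rw [rhoApprox, HahnSeries.coeff_add, HahnSeries.coeff_truncLT_of_le hq.le,
    HahnSeries.coeff_single_of_ne hq.ne', add_zero]

theorem coeff_rhoApprox_self (φ : HahnSeries ℚ ℂ) (ρ : ℚ) (g : ℂ) :
    (rhoApprox φ ρ g).coeff ρ = g := by
  rw [rhoApprox, HahnSeries.coeff_add, HahnSeries.coeff_truncLT_of_le le_rfl,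
    HahnSeries.coeff_single_same, zero_add]

theorem rhoApprox_congr {φ φ' : HahnSeries ℚ ℂ} {ρ : ℚ} (h : ∀ q < ρ, φ'.coeff q = φ.coeff q)
    (g : ℂ) : rhoApprox φ' ρ g = rhoApprox φ ρ g := by
  ext q
  rcases lt_trichotomy q ρ with hq | rfl | hq
  · rw [coeff_rhoApprox_of_lt g hq, coeff_rhoApprox_of_lt g hq, h q hq]
  · rw [coeff_rhoApprox_self, coeff_rhoApprox_self]
  · rw [coeff_rhoApprox_of_gt g hq, coeff_rhoApprox_of_gt g hq]

theorem IsPuiseuxOfDenom.rhoApprox {N σ : ℕ} (hσ : 0 < σ) {φ : HahnSeries ℚ ℂ}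
    (h : IsPuiseuxOfDenom N φ) (g : ℂ) : IsPuiseuxOfDenom N (rhoApprox φ ((σ : ℚ) / N) g) := by
  have hN : (0 : ℚ) < N := by exact_mod_cast h.1
  refine ⟨h.1, fun q hq => ?_, 1, one_pos, ?_⟩
  · rcases lt_trichotomy q ((σ : ℚ) / N) with hlt | rfl | hlt
    · rw [coeff_rhoApprox_of_lt g hlt] at hq
      exact h.2.1 q hq
    · exact ⟨σ, hσ, rfl⟩
    · exact absurd (coeff_rhoApprox_of_gt g hlt) hq
  · refine summable_of_ne_finset_zero (s := Finset.range (σ + 1)) fun n hn => ?_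
    rw [coeff_rhoApprox_of_gt g, norm_zero, zero_mul]
    have : (σ : ℚ) < n := by
      rw [Finset.mem_range] at hn
      exact_mod_cast (by omega : σ < n)
    gcongr

theorem contactOrder_eq {φ φ' : HahnSeries ℚ ℂ} {ρ : ℚ} (h : ∀ q < ρ, φ'.coeff q = φ.coeff q)
    (hne : φ'.coeff ρ ≠ φ.coeff ρ) : contactOrder φ φ' = ρ := by
  have h1 : (φ - φ').coeff ρ ≠ 0 := by
    rw [HahnSeries.coeff_sub]
    exact sub_ne_zero.2 (Ne.symm hne)
  refine le_antisymm (HahnSeries.order_le_of_coeff_ne_zero h1) (not_lt.1 fun hlt => ?_)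
  have h2 : φ - φ' ≠ 0 := by rintro h; rw [h] at h1; exact h1 rfl
  apply h2
  rw [← HahnSeries.coeff_order_eq_zero, HahnSeries.coeff_sub]
  exact sub_eq_zero.2 (h _ hlt).symm

theorem coeff_eq_of_lt_contactOrder {φ φ' : HahnSeries ℚ ℂ} {q : ℚ} (h : q < contactOrder φ φ') :
    φ'.coeff q = φ.coeff q := by
  have := HahnSeries.coeff_eq_zero_of_lt_order h
  rw [HahnSeries.coeff_sub, sub_eq_zero] at this
  exact this.symm

theorem coeff_contactOrder_ne {φ φ' : HahnSeries ℚ ℂ} (h : φ ≠ φ') :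
    φ'.coeff (contactOrder φ φ') ≠ φ.coeff (contactOrder φ φ') := fun he => by
  have h2 : φ - φ' ≠ 0 := sub_ne_zero.2 h
  apply h2
  rw [← HahnSeries.coeff_order_eq_zero, HahnSeries.coeff_sub]
  exact sub_eq_zero.2 he.symm

/-- The two series agree below their contact order; hence the ordering i < j of a pair is
immaterial. -/
theorem approx_comm {φ φ' : HahnSeries ℚ ℂ} (h : φ ≠ φ') (g : ℂ) :
    approx φ φ' g = approx φ' φ g := by
  have h1 : contactOrder φ' φ = contactOrder φ φ' :=
    contactOrder_eq (fun q hq => (coeff_eq_of_lt_contactOrder hq).symm)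
      (Ne.symm (coeff_contactOrder_ne h))
  rw [approx, approx, h1]
  exact (rhoApprox_congr (fun q hq => coeff_eq_of_lt_contactOrder hq) g).symm

/-! ### Roots, and the order along a series -/

theorem ordAlong_eq_top_iff {f : ℂ × ℂ → ℂ} {φ : HahnSeries ℚ ℂ} :
    ordAlong f φ = ⊤ ↔ ∀ᶠ t in 𝓝 (0 : ℂ), pullback f φ (denom φ) t = 0 := by
  rw [← analyticOrderAt_eq_top, ordAlong]
  exact WithTop.map_eq_top_iff

theorem isNewtonPuiseuxRoot_iff {f : ℂ × ℂ → ℂ} (hf : AnalyticAt ℂ f 0) {N : ℕ}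
    {φ : HahnSeries ℚ ℂ} (h : IsPuiseuxOfDenom N φ) :
    IsNewtonPuiseuxRoot f φ ↔ ∀ᶠ t in 𝓝 (0 : ℂ), pullback f φ N t = 0 := by
  rw [IsNewtonPuiseuxRoot, ← ordAlong_eq_top_iff, ordAlong_eq hf h, ← analyticOrderAt_eq_top]
  exact ⟨fun h1 => WithTop.map_eq_top_iff.1 h1.2, fun h1 => ⟨⟨N, h⟩, WithTop.map_eq_top_iff.2 h1⟩⟩

theorem ordAlong_of_order {f : ℂ × ℂ → ℂ} (hf : AnalyticAt ℂ f 0) {N M : ℕ}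
    {φ : HahnSeries ℚ ℂ} (h : IsPuiseuxOfDenom N φ)
    (hM : analyticOrderAt (pullback f φ N) 0 = M) :
    ordAlong f φ = (((M : ℚ) / N : ℚ) : WithTop ℚ) := by
  rw [ordAlong_eq hf h, hM]
  rfl

/-- The k-th derivative of f(x, 0) at 0 is k! f_k(1, 0). Mini-regularity enters the argument in this
form. -/
theorem analyticOrderAt_section_of_isMiniRegularInX {f : ℂ × ℂ → ℂ} (hf : AnalyticAt ℂ f 0) {m : ℕ}
    (hm : IsMiniRegularInX f m) : analyticOrderAt (fun x => f (x, 0)) 0 = m := by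
  obtain ⟨p, r, hp⟩ := hf
  let L : ℂ →L[ℂ] ℂ × ℂ := ContinuousLinearMap.inl ℂ ℂ ℂ
  have hp' : HasFPowerSeriesAt f p (L 0) := by simpa using hp.hasFPowerSeriesAt
  obtain ⟨r', hq⟩ := hp'.compContinuousLinearMap
  have key : ∀ k, iteratedDeriv k (fun x => f (x, 0)) 0 = iteratedFDeriv ℂ k f 0 fun _ => (1, 0) :=
    fun k => by
      rw [iteratedDeriv_eq_iteratedFDeriv, ← hp.factorial_smul]
      have := hq.factorial_smul (1 : ℂ) k
      simp only [FormalMultilinearSeries.compContinuousLinearMap_apply] at this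
      exact this.symm
  rw [analyticOrderAt_eq_nat_iff_iteratedDeriv_eq_zero (analyticAt_section hp.analyticAt)]
  simp only [key]
  have hfac : ∀ k : ℕ, ((k.factorial : ℂ))⁻¹ ≠ 0 := fun k =>
    inv_ne_zero (by exact_mod_cast k.factorial_ne_zero)
  refine ⟨fun k hk => ?_, ?_⟩
  · exact (mul_eq_zero.1 (hm.1 k hk (1, 0))).resolve_left (hfac k)
  · exact (mul_ne_zero_iff.1 hm.2).2

/-! ### Rescaling along a series -/

/-- The germ `(x, t) ↦ f(φ(t^N) + x, t^N)`. -/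
def shiftAlong (f : ℂ × ℂ → ℂ) (φ : HahnSeries ℚ ℂ) (N : ℕ) : ℂ × ℂ → ℂ :=
  fun p => f (param φ N p.2 + p.1, p.2 ^ N)

theorem analyticAt_shiftAlong {f : ℂ × ℂ → ℂ} (hf : AnalyticAt ℂ f 0) {N : ℕ}
    {φ : HahnSeries ℚ ℂ} (h : IsPuiseuxOfDenom N φ) : AnalyticAt ℂ (shiftAlong f φ N) 0 :=
  analyticAt_shift hf h.analyticAt_param h.param_zero h.1

theorem shiftAlong_section {f : ℂ × ℂ → ℂ} {N : ℕ} {φ : HahnSeries ℚ ℂ}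
    (h : IsPuiseuxOfDenom N φ) : (fun x => shiftAlong f φ N (x, 0)) = fun x => f (x, 0) := by
  funext x
  simp [shiftAlong, h.param_zero, h.1.ne']

theorem shiftAlong_mul {f : ℂ × ℂ → ℂ} {N k : ℕ} (hk : 0 < k) {φ : HahnSeries ℚ ℂ}
    (h : IsPuiseuxOfDenom N φ) :
    shiftAlong f φ (N * k) = fun p => shiftAlong f φ N (p.1, p.2 ^ k) := by
  funext p
  simp only [shiftAlong, h.param_mul hk, ← pow_mul, mul_comm k N]

theorem tendsto_prodMk_zero {z : ℂ → ℂ} (hz : AnalyticAt ℂ z 0) :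
    Tendsto (fun t : ℂ => (z t, t)) (𝓝 0) (𝓝 (z 0, 0)) :=
  (hz.continuousAt.prodMk continuousAt_id).tendsto

theorem IsRescaling.order_pullback {f : ℂ × ℂ → ℂ} {N σ M : ℕ} {φ φ' : HahnSeries ℚ ℂ}
    {H : ℂ × ℂ → ℂ} {P : Polynomial ℂ} (hH : IsRescaling (shiftAlong f φ N) σ M H P)
    {z : ℂ → ℂ} (hz : AnalyticAt ℂ z 0)
    (he : ∀ᶠ t in 𝓝 (0 : ℂ), param φ' N t = param φ N t + t ^ σ * z t) :
    (∀ᶠ t in 𝓝 (0 : ℂ), pullback f φ' N t = t ^ M * H (z t, t)) := by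
  filter_upwards [he, (tendsto_prodMk_zero hz).eventually (hH.eventually_eq _)] with t h1 h2
  simp only [shiftAlong] at h2
  rw [← h2, pullback, h1, mul_comm (z t)]

/-- Where P does not vanish, H(z(t), t) is a unit, so only the factor t^M contributes to the order.
-/
theorem IsRescaling.ordAlong_eq {f : ℂ × ℂ → ℂ} (hf : AnalyticAt ℂ f 0) {N σ M : ℕ}
    {φ φ' : HahnSeries ℚ ℂ} {H : ℂ × ℂ → ℂ} {P : Polynomial ℂ}
    (hH : IsRescaling (shiftAlong f φ N) σ M H P) (hφ' : IsPuiseuxOfDenom N φ')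
    {z : ℂ → ℂ} (hz : AnalyticAt ℂ z 0)
    (he : ∀ᶠ t in 𝓝 (0 : ℂ), param φ' N t = param φ N t + t ^ σ * z t) (hP : P.eval (z 0) ≠ 0) :
    ordAlong f φ' = (((M : ℚ) / N : ℚ) : WithTop ℚ) := by
  refine ordAlong_of_order hf hφ' ?_
  rw [(analyticAt_pullback hf hφ').analyticOrderAt_eq_natCast]
  refine ⟨fun t => H (z t, t), ?_, ?_, ?_⟩
  · exact AnalyticAt.fun_comp (f := fun t => (z t, t)) (hH.analyticAt (z 0)) (hz.prod analyticAt_id)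
  · simpa [hH.eval_eq] using hP
  · simpa using hH.order_pullback hz he

theorem IsRescaling.eval_eq_zero_of_root {f : ℂ × ℂ → ℂ} {N σ M : ℕ}
    {φ φ' : HahnSeries ℚ ℂ} {H : ℂ × ℂ → ℂ} {P : Polynomial ℂ}
    (hf : AnalyticAt ℂ f 0) (hH : IsRescaling (shiftAlong f φ N) σ M H P)
    (hφ' : IsPuiseuxOfDenom N φ') (hroot : IsNewtonPuiseuxRoot f φ')
    {z : ℂ → ℂ} (hz : AnalyticAt ℂ z 0)
    (he : ∀ᶠ t in 𝓝 (0 : ℂ), param φ' N t = param φ N t + t ^ σ * z t) : P.eval (z 0) = 0 := by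
  by_contra hP
  have h1 := hH.ordAlong_eq hf hφ' hz he hP
  rw [ordAlong_eq_top_iff.2 hroot.2] at h1
  exact WithTop.top_ne_coe h1

/-- The order along the approximations of `φ` of exponent `σ/N` is generically `M/N`. -/
theorem IsRescaling.eventually_ordAlong_rhoApprox {f : ℂ × ℂ → ℂ} (hf : AnalyticAt ℂ f 0)
    {N σ M : ℕ} {φ : HahnSeries ℚ ℂ} {H : ℂ × ℂ → ℂ} {P : Polynomial ℂ}
    (hH : IsRescaling (shiftAlong f φ N) σ M H P) (hφ : IsPuiseuxOfDenom N φ) (hσ : 0 < σ)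
    (hP : P ≠ 0) :
    ∀ᶠ g : ℂ in cofinite,
      ordAlong f (rhoApprox φ ((σ : ℚ) / N) g) = (((M : ℚ) / N : ℚ) : WithTop ℚ) := by
  -- The constant g corresponds to z(0) = g minus the coefficient of φ, so the exceptional g are
  -- translated roots of P.
  have hfin : {g : ℂ | P.IsRoot (g - φ.coeff ((σ : ℚ) / N))}.Finite := by
    refine Set.Finite.preimage (f := fun g : ℂ => g - φ.coeff ((σ : ℚ) / N))
      (sub_left_injective.injOn) (s := {x | P.IsRoot x}) ?_
    exact Polynomial.finite_setOfPred_isRoot hP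
  filter_upwards [hfin.compl_mem_cofinite] with g hg
  obtain ⟨z, hz, hz0, he⟩ := hφ.exists_param_eq_add (hφ.rhoApprox hσ g)
    (fun q hq => coeff_rhoApprox_of_lt g hq)
  refine hH.ordAlong_eq hf (hφ.rhoApprox hσ g) hz he ?_
  rw [hz0, coeff_rhoApprox_self]
  exact hg

/-- A series with a given leading behaviour relative to `φ`, after ramification of order `n`. -/
theorem exists_lift {N σ n : ℕ} (hn : 0 < n) (hσ : 0 < σ) {φ : HahnSeries ℚ ℂ}
    (hφ : IsPuiseuxOfDenom N φ) {z : ℂ → ℂ} (hz : AnalyticAt ℂ z 0) :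
    ∃ γ : HahnSeries ℚ ℂ, IsPuiseuxOfDenom (N * n) γ ∧
      (∀ᶠ w in 𝓝 (0 : ℂ), param γ (N * n) w = param φ N (w ^ n) + w ^ (n * σ) * z w) ∧
      (∀ q < (σ : ℚ) / N, γ.coeff q = φ.coeff q) ∧
      γ.coeff ((σ : ℚ) / N) = φ.coeff ((σ : ℚ) / N) + z 0 := by
  have hφn := hφ.mul hn
  obtain ⟨γ, hγ, he⟩ := exists_isPuiseuxOfDenom_param_eq (ψ := fun w =>
    param φ (N * n) w + w ^ (n * σ) * z w) (hφn.1)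
    (hφn.analyticAt_param.add ((analyticAt_id.pow _).mul hz))
    (by
      have h0 : (0 : ℂ) ^ (n * σ) = 0 := zero_pow (by positivity)
      simp [hφn.param_zero, h0])
  have he' : ∀ᶠ w in 𝓝 (0 : ℂ), param γ (N * n) w = param φ (N * n) w + w ^ (n * σ) * z w := he
  have hc := hφn.coeff_of_param_eq_add hγ hz he'
  have hq : ((n * σ : ℕ) : ℚ) / (N * n : ℕ) = (σ : ℚ) / N := by
    have : (n : ℚ) ≠ 0 := by positivity
    have : (N : ℚ) ≠ 0 := by exact_mod_cast hφ.1.ne'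
    push_cast
    field_simp
  rw [hq] at hc
  refine ⟨γ, hγ, ?_, hc.1, hc.2⟩
  filter_upwards [he'] with w hw
  rw [hw, hφ.param_mul hn]

theorem tendsto_prodMk_pow {z : ℂ → ℂ} (hz : AnalyticAt ℂ z 0) {n : ℕ} (hn : 0 < n) :
    Tendsto (fun w : ℂ => (z w, w ^ n)) (𝓝 0) (𝓝 (z 0, 0)) := by
  have h : ContinuousAt (fun w : ℂ => (z w, w ^ n)) 0 :=
    hz.continuousAt.prodMk (by fun_prop)
  have := h.tendsto
  rwa [zero_pow hn.ne'] at this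

theorem IsRescaling.pullback_lift {f : ℂ × ℂ → ℂ} {N σ M n : ℕ} (hn : 0 < n)
    {φ γ : HahnSeries ℚ ℂ} {H : ℂ × ℂ → ℂ} {P : Polynomial ℂ}
    (hH : IsRescaling (shiftAlong f φ N) σ M H P) {z : ℂ → ℂ} (hz : AnalyticAt ℂ z 0)
    (he : ∀ᶠ w in 𝓝 (0 : ℂ), param γ (N * n) w = param φ N (w ^ n) + w ^ (n * σ) * z w) :
    ∀ᶠ w in 𝓝 (0 : ℂ), pullback f γ (N * n) w = w ^ (n * M) * H (z w, w ^ n) := by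
  filter_upwards [he, (tendsto_prodMk_pow hz hn).eventually (hH.eventually_eq _)] with w h1 h2
  simp only [shiftAlong] at h2
  rw [pow_mul w n M, ← h2, pullback, h1, pow_mul, mul_comm (z w), mul_comm N n, pow_mul]

/-- Differentiation of `f(φ(t^N) + z t^σ, t^N) = t^M H(z, t)` with respect to `z`. -/
theorem IsRescaling.eventually_partialX {f : ℂ × ℂ → ℂ} (hf : AnalyticAt ℂ f 0) {N σ M : ℕ}
    (hσ : 0 < σ) {φ : HahnSeries ℚ ℂ} (hφ : IsPuiseuxOfDenom N φ)
    {H : ℂ × ℂ → ℂ} {P : Polynomial ℂ} (hH : IsRescaling (shiftAlong f φ N) σ M H P) (a : ℂ) :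
    ∀ᶠ p in 𝓝 (a, (0 : ℂ)), p.2 ^ σ * partialX f (param φ N p.2 + p.2 ^ σ * p.1, p.2 ^ N) =
      p.2 ^ M * partialX H p := by
  have hcont : ContinuousAt
      (fun p : ℂ × ℂ => (param φ N p.2 + p.2 ^ σ * p.1, p.2 ^ N)) (a, 0) := by
    have h1 : ContinuousAt (fun p : ℂ × ℂ => param φ N p.2) (a, 0) :=
      ContinuousAt.comp (g := param φ N) (f := Prod.snd) (x := (a, (0 : ℂ))) hφ.analyticAt_param.continuousAt
        continuousAt_snd
    exact (h1.add (by fun_prop)).prodMk (by fun_prop)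
  have ht := hcont.tendsto
  simp only [hφ.param_zero, zero_pow hσ.ne', zero_pow hφ.1.ne', zero_mul, add_zero] at ht
  filter_upwards [(hH.eventually_eq a).eventually_nhds, (hH.analyticAt a).eventually_analyticAt,
    ht.eventually hf.eventually_analyticAt] with p h1 h2 h3
  have hx : Tendsto (fun z : ℂ => (z, p.2)) (𝓝 p.1) (𝓝 p) := by
    have : Continuous fun z : ℂ => (z, p.2) := by fun_prop
    exact this.tendsto' p.1 p rfl
  have h4 : HasDerivAt (fun z => p.2 ^ M * H (z, p.2)) (p.2 ^ M * partialX H p) p.1 :=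
    (hasDerivAt_partialX h2).const_mul _
  have h5 : HasDerivAt (fun z => param φ N p.2 + p.2 ^ σ * z) (p.2 ^ σ) p.1 := by
    simpa using ((hasDerivAt_id p.1).const_mul (p.2 ^ σ)).const_add (param φ N p.2)
  have h6 := HasDerivAt.comp p.1 (hasDerivAt_partialX h3) h5
  have h7 : (fun z => p.2 ^ M * H (z, p.2)) =ᶠ[𝓝 p.1]
      ((fun x => f (x, p.2 ^ N)) ∘ fun z => param φ N p.2 + p.2 ^ σ * z) := by
    filter_upwards [hx.eventually h1] with z hz
    simp only [shiftAlong] at hz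
    simp only [Function.comp_apply]
    rw [← hz, mul_comm z]
  rw [mul_comm]
  exact (h6.congr_of_eventuallyEq h7).unique h4

theorem IsRescaling.partialX_eval {h : ℂ × ℂ → ℂ} {σ M : ℕ}
    {H : ℂ × ℂ → ℂ} {P : Polynomial ℂ} (hH : IsRescaling h σ M H P) (a : ℂ) :
    partialX H (a, 0) = (Polynomial.derivative P).eval a := by
  simp only [partialX, hH.eval_eq]
  exact P.deriv

/-! ### Slopes -/

/-- Here the slope σ is prescribed by a contact order and the supporting line is sought. That the
minimum is attained makes P nonzero. -/
theorem exists_minimal_value (e : ℕ → ℕ∞) (d σ : ℕ) :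
    ∃ M : ℕ, M ≤ d * σ ∧ (∀ k < d, (M : ℕ∞) ≤ e k + (k * σ : ℕ)) ∧
      (d * σ = M ∨ ∃ k < d, e k + (k * σ : ℕ) = M) := by
  classical
  let e' : ℕ → ℕ∞ := fun k => if k < d then e k + (k * σ : ℕ) else (d * σ : ℕ)
  obtain ⟨k₀, hk₀, hmin⟩ := (Finset.range (d + 1)).exists_min_image e' ⟨0, by simp⟩
  have hd : e' k₀ ≤ (d * σ : ℕ) := by
    simpa [e'] using hmin d (by simp)
  obtain ⟨M, hM⟩ := ENat.ne_top_iff_exists.1 (ne_top_of_le_ne_top (ENat.natCast_ne_top _) hd)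
  rw [← hM] at hd hmin
  refine ⟨M, by exact_mod_cast hd, fun k hk => ?_, ?_⟩
  · simpa [e', hk] using hmin k (by simp; omega)
  · by_cases hk : k₀ < d
    · right
      refine ⟨k₀, hk, ?_⟩
      simpa [e', hk] using hM.symm
    · left
      simp only [e', hk, if_false] at hM
      exact_mod_cast hM.symm

/-- The steepest descent (E - e k) / k from the vertex (0, E) is attained at k₀, with s = E - e k₀;
`he` makes it positive. The inequality puts every (k, e k) on or above that line. -/
theorem exists_maximal_slope {d E : ℕ} (hd : 0 < d) (hE : 0 < E) (e : ℕ → ℕ∞) (he : e d = 0) :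
    ∃ k₀ s : ℕ, 0 < k₀ ∧ k₀ ≤ d ∧ 0 < s ∧ e k₀ + s = E ∧
      ∀ k, 0 < k → k ≤ d → ((E * k₀ : ℕ) : ℕ∞) ≤ e k * k₀ + (k * s : ℕ) := by
  classical
  let S := (Finset.Icc 1 d).filter fun k => e k ≠ ⊤
  have hdS : d ∈ S := by simp [S, he]; omega
  obtain ⟨k₀, hk₀, hmax⟩ := S.exists_max_image (fun k => ((E : ℚ) - (e k).toNat) / k) ⟨d, hdS⟩
  have hd1 := hmax d hdS
  simp only [S, Finset.mem_filter, Finset.mem_Icc] at hk₀ hmax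
  obtain ⟨⟨hk1, hk2⟩, hk3⟩ := hk₀
  have hk₀' : (0 : ℚ) < k₀ := by exact_mod_cast hk1
  have hpos : (0 : ℚ) < E - (e k₀).toNat := by
    have h1 : (0 : ℚ) < ((E : ℚ) - (e d).toNat) / d := by
      rw [he]
      simp only [ENat.toNat_zero, Nat.cast_zero, sub_zero]
      positivity
    have h2 := h1.trans_le hd1
    exact (div_pos_iff_of_pos_right hk₀').1 h2
  have hlt : (e k₀).toNat < E := by
    have : ((e k₀).toNat : ℚ) < E := by linarith
    exact_mod_cast this
  refine ⟨k₀, E - (e k₀).toNat, hk1, hk2, Nat.sub_pos_of_lt hlt, ?_, fun k h1 h2 => ?_⟩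
  · rw [← ENat.natCast_toNat hk3, ENat.toNat_natCast]
    norm_cast
    omega
  · by_cases hkt : e k = ⊤
    · rw [hkt, ENat.top_mul (by exact_mod_cast (by omega : k₀ ≠ 0)), top_add]
      exact le_top
    · have h3 := hmax k ⟨⟨h1, h2⟩, hkt⟩
      have hk' : (0 : ℚ) < k := by exact_mod_cast h1
      rw [div_le_div_iff₀ hk' hk₀'] at h3
      rw [← ENat.natCast_toNat hkt]
      have h4 : (E * k₀ : ℚ) ≤ (e k).toNat * k₀ + k * (E - (e k₀).toNat : ℕ) := by
        rw [Nat.cast_sub hlt.le]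
        linarith
      exact_mod_cast h4

/-! ### Polar branches and approximations -/

theorem exists_polarBranch_of_roots {f : ℂ × ℂ → ℂ} (hf : AnalyticAt ℂ f 0) {d : ℕ}
    (hd : analyticOrderAt (fun x => f (x, 0)) 0 = d) {φ φ' : HahnSeries ℚ ℂ}
    (hφ : IsNewtonPuiseuxRoot f φ) (hφ' : IsNewtonPuiseuxRoot f φ') (hne : φ ≠ φ') :
    ∃ q : ℚ, IsGenericOrd f φ φ' (q : WithTop ℚ) ∧ ∃ γ ∈ polarBranches f, ordAlong f γ = q := by
  obtain ⟨N₁, h₁⟩ := hφ.1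
  obtain ⟨N₂, h₂⟩ := hφ'.1
  obtain ⟨N, h, h'⟩ : ∃ N, IsPuiseuxOfDenom N φ ∧ IsPuiseuxOfDenom N φ' :=
    ⟨N₁ * N₂, h₁.mul h₂.1, mul_comm N₁ N₂ ▸ h₂.mul h₁.1⟩
  have hcne := coeff_contactOrder_ne hne
  -- One of the two series has a nonzero coefficient at the contact order, which is therefore a
  -- positive multiple of 1/N.
  obtain ⟨σ, hσ, hρ⟩ : ∃ σ : ℕ, 0 < σ ∧ contactOrder φ φ' = (σ : ℚ) / N := by
    by_cases hz : φ.coeff (contactOrder φ φ') = 0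
    · exact h'.2.1 _ (by rwa [hz] at hcne)
    · exact h.2.1 _ hz
  have hh := analyticAt_shiftAlong hf h
  obtain ⟨c, U, hE⟩ := exists_hasExpansion hh d
  obtain ⟨-, hU⟩ := hE.of_order hh (by rw [shiftAlong_section h]; exact hd)
  obtain ⟨M, hMd, hMk, hMeq⟩ := exists_minimal_value (fun k => analyticOrderAt (c k) 0) d σ
  obtain ⟨H, P, hH, -, hPk, hPd⟩ := hE.exists_isRescaling hU hσ hMk hMd
  have hP : P ≠ 0 := by
    rintro rfl
    rcases hMeq with hM | ⟨k, hk, hM⟩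
    · exact hPd.2 hM rfl
    · exact (hPk k hk).2 hM rfl
  refine ⟨(M : ℚ) / N, ?_, ?_⟩
  · change ∀ᶠ g in cofinite, ordAlong f (rhoApprox φ (contactOrder φ φ') g) = _
    rw [hρ]
    exact hH.eventually_ordAlong_rhoApprox hf h hσ hP
  -- `P` has the distinct roots `0` and `z 0`
  obtain ⟨z, hz, hz0, hze⟩ := h.exists_param_eq_add h' (σ := σ) fun q hq =>
    coeff_eq_of_lt_contactOrder (hρ ▸ hq)
  have hzne : z 0 ≠ 0 := by
    rw [hz0, ← hρ]
    exact sub_ne_zero.2 hcne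
  have hroot1 : P.IsRoot (z 0) := hH.eval_eq_zero_of_root hf h' hφ' hz hze
  have hroot0 : P.IsRoot 0 := hH.eval_eq_zero_of_root (z := fun _ => 0) hf h hφ analyticAt_const
    (by simp)
  obtain ⟨a, ha, haP⟩ := exists_derivative_root hP hzne hroot1 hroot0
  have hP' : Polynomial.derivative P ≠ 0 := fun h0 => by
    obtain ⟨b, hb⟩ := Polynomial.natDegree_eq_zero.1 (Polynomial.derivative_eq_zero.1 h0)
    rw [← hb] at hroot0 haP
    simp only [Polynomial.IsRoot, Polynomial.eval_C] at hroot0 haP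
    exact haP hroot0
  have hK : AnalyticAt ℂ (fun p : ℂ × ℂ => partialX H (a + p.1, p.2)) 0 := by
    refine AnalyticAt.fun_comp (f := fun p : ℂ × ℂ => (a + p.1, p.2)) ?_
      ((analyticAt_const.add analyticAt_fst).prod analyticAt_snd)
    simpa using analyticAt_partialX (hH.analyticAt a)
  obtain ⟨n, hn, ψ, hψ, hψ0, hψr⟩ := exists_puiseux_root
    ((Polynomial.rootMultiplicity_pos hP').2 ha) hK
    (by simp only [hH.partialX_eval]; exact analyticOrderAt_eval_add hP' a)
  have hza : AnalyticAt ℂ (fun w => a + ψ w) 0 := analyticAt_const.add hψ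
  obtain ⟨γ, hγ, hγe, -, -⟩ := exists_lift hn hσ h hza
  have hord : ordAlong f γ = (((M : ℚ) / N : ℚ) : WithTop ℚ) := by
    have hM : analyticOrderAt (pullback f γ (N * n)) 0 = (n * M : ℕ) := by
      rw [(analyticAt_pullback hf hγ).analyticOrderAt_eq_natCast]
      refine ⟨fun w => H (a + ψ w, w ^ n), ?_, ?_, ?_⟩
      · refine AnalyticAt.fun_comp (f := fun w => (a + ψ w, w ^ n)) ?_
          (hza.prod (analyticAt_id.pow n))
        simpa [hψ0, hn.ne'] using hH.analyticAt a
      · simpa [hψ0, hn.ne', hH.eval_eq] using haP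
      · simpa using hH.pullback_lift hn hza hγe
    rw [ordAlong_of_order hf hγ hM]
    have h1 : (n : ℚ) ≠ 0 := by positivity
    have h2 : (N : ℚ) ≠ 0 := by exact_mod_cast h.1.ne'
    congr 1
    push_cast
    field_simp
  refine ⟨γ, ⟨?_, fun hr => ?_⟩, hord⟩
  · have hpf := analyticAt_partialX hf
    rw [isNewtonPuiseuxRoot_iff hpf hγ,
      ← (analyticAt_pullback hpf hγ).frequently_zero_iff_eventually_zero]
    -- The factor `(w ^ n) ^ σ` cancels only off the origin; vanishing on a punctured neighbourhood
    -- suffices for an analytic germ.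
    refine Eventually.frequently (f := 𝓝[≠] (0 : ℂ)) ?_
    have ht := tendsto_prodMk_pow hza hn
    simp only [hψ0, add_zero] at ht
    filter_upwards [self_mem_nhdsWithin, nhdsWithin_le_nhds hγe, nhdsWithin_le_nhds hψr,
      nhdsWithin_le_nhds (ht.eventually (hH.eventually_partialX hf hσ h a))] with w hw h1 h2 h3
    rw [h2, mul_zero] at h3
    have hw' : (w ^ n) ^ σ ≠ 0 := pow_ne_zero _ (pow_ne_zero _ hw)
    have h4 := (mul_eq_zero.1 h3).resolve_left hw'
    rw [pullback, h1, mul_comm N n, pow_mul, pow_mul]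
    exact h4
  · rw [ordAlong_eq_top_iff.2 hr.2] at hord
    exact WithTop.top_ne_coe hord

theorem exists_roots_of_polarBranch {f : ℂ × ℂ → ℂ} (hf : AnalyticAt ℂ f 0) (hf0 : f 0 = 0) {d : ℕ}
    (hd : analyticOrderAt (fun x => f (x, 0)) 0 = d) {γ : HahnSeries ℚ ℂ}
    (hγ : γ ∈ polarBranches f) :
    ∃ φ φ', IsNewtonPuiseuxRoot f φ ∧ IsNewtonPuiseuxRoot f φ' ∧ φ ≠ φ' ∧
      IsGenericOrd f φ φ' (ordAlong f γ) := by
  obtain ⟨hγr, hγn⟩ := hγ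
  obtain ⟨N, h⟩ := hγr.1
  rw [isNewtonPuiseuxRoot_iff (analyticAt_partialX hf) h] at hγr
  rw [isNewtonPuiseuxRoot_iff hf h] at hγn
  have hsec := (analyticOrderAt_eq_nat_iff_iteratedDeriv_eq_zero (analyticAt_section hf)).1 hd
  have hd0 : d ≠ 0 := by
    rintro rfl
    exact hsec.2 hf0
  -- For d = 1 the derivative ∂f/∂x is nonzero at the origin and has no root there. So 1 < d, and `c
  -- 1` is a genuine coefficient of the expansion.
  have hd1 : d ≠ 1 := by
    rintro rfl
    apply hsec.2
    have h1 := hγr.self_of_nhds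
    simpa [pullback, h.param_zero, h.1.ne', partialX, iteratedDeriv_one] using h1
  have hh := analyticAt_shiftAlong hf h
  obtain ⟨c, U, hE⟩ := exists_hasExpansion hh d
  obtain ⟨hc0, hU⟩ := hE.of_order hh (by rw [shiftAlong_section h]; exact hd)
  -- the coefficients of `x` and of `1`
  have hc1 : analyticOrderAt (c 1) 0 = ⊤ := by
    rw [analyticOrderAt_eq_top]
    filter_upwards [hE.iteratedDeriv_eq hh, hγr] with t h1 h2
    have h3 := h1 1 (by omega)
    have h4 := deriv_comp_const_add (fun x => f (x, t ^ N)) (param γ N t) 0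
    rw [add_zero] at h4
    rw [iteratedDeriv_one, Nat.factorial_one, Nat.cast_one, one_mul] at h3
    rw [← h3]
    exact h4.trans h2
  have hc0t : analyticOrderAt (c 0) 0 ≠ ⊤ := fun hc => by
    rw [analyticOrderAt_eq_top] at hc
    apply hγn
    filter_upwards [hE.iteratedDeriv_eq hh, hc] with t h1 h2
    have h3 := h1 0 (by omega)
    rw [h2, mul_zero, iteratedDeriv_zero] at h3
    simpa [shiftAlong, pullback] using h3
  obtain ⟨E, hEe⟩ := ENat.ne_top_iff_exists.1 hc0t
  have hE0 : 0 < E := by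
    have h1 : analyticOrderAt (c 0) 0 ≠ 0 :=
      (hE.analyticAt_coeff 0).analyticOrderAt_ne_zero.2 (hc0 0 (by omega))
    rw [← hEe] at h1
    exact Nat.pos_of_ne_zero (by exact_mod_cast h1)
  -- The value 0 at k = d is the order of the unit in front of x^d.
  obtain ⟨q, σ, hq, hqd, hσ, hqσ, hslope⟩ := exists_maximal_slope (d := d) (by omega) hE0
    (fun k => if k < d then analyticOrderAt (c k) 0 else 0) (by simp)
  -- after ramification of order `q`, rescale by `σ`
  have hNq := h.mul hq
  have hEq := hE.comp_pow hq
  rw [← shiftAlong_mul hq h] at hEq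
  have ho : ∀ k, analyticOrderAt (fun t => c k (t ^ q)) 0 = analyticOrderAt (c k) 0 * (q : ℕ) :=
    fun k => analyticOrderAt_comp_pow (hE.analyticAt_coeff k) hq
  obtain ⟨H, P, hH, -, hPk, hPd⟩ := hEq.exists_isRescaling (σ := σ) (M := E * q)
    (by
      show U ((0 : ℂ), (0 : ℂ) ^ q) ≠ 0
      rw [zero_pow hq.ne']
      exact hU) hσ
    (fun k hk => by
      rw [ho]
      rcases Nat.eq_zero_or_pos k with rfl | hk0
      · rw [← hEe]
        norm_cast
        simp
      · simpa [hk] using hslope k hk0 hk.le)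
    (by
      have := hslope d (by omega) le_rfl
      simp only [lt_irrefl, if_false, zero_mul, zero_add] at this
      exact_mod_cast this)
  have hP0 : P.coeff 0 ≠ 0 := (hPk 0 (by omega)).2 (by
    rw [ho, ← hEe]
    norm_cast
    simp)
  have hP1 : P.coeff 1 = 0 := by
    by_contra hne
    have h1 := (hPk 1 (by omega)).1 hne
    rw [ho, hc1, ENat.top_mul (by exact_mod_cast hq.ne'), top_add] at h1
    exact absurd h1.symm (ENat.natCast_ne_top _)
  have hPq : P.coeff q ≠ 0 := by
    rcases hqd.eq_or_lt with rfl | hlt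
    · rw [hPd]
      simp only [lt_irrefl, if_false, zero_add] at hqσ
      have : σ = E := by exact_mod_cast hqσ
      rw [this, mul_comm]
    · rw [hPk q hlt, ho]
      simp only [hlt, if_true] at hqσ
      rw [Nat.cast_mul, Nat.cast_mul, ← hqσ]
      ring
  have hPne : P ≠ 0 := by rintro rfl; exact hP0 rfl
  obtain ⟨a, b, hab, ha, hb⟩ := exists_two_roots hP0 hP1 hq hPq
  -- every root of `P` lifts to a root of `f`
  have hlift : ∀ a, P.IsRoot a → ∃ φ, IsNewtonPuiseuxRoot f φ ∧
      (∀ x < (σ : ℚ) / (N * q : ℕ), φ.coeff x = γ.coeff x) ∧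
      φ.coeff ((σ : ℚ) / (N * q : ℕ)) = γ.coeff ((σ : ℚ) / (N * q : ℕ)) + a := fun a ha => by
    obtain ⟨n, hn, ψ, hψ, hψ0, hψr⟩ := exists_puiseux_root
      ((Polynomial.rootMultiplicity_pos hPne).2 ha) (hH.analyticAt_shift a)
      (by simp only [hH.eval_eq]; exact analyticOrderAt_eval_add hPne a)
    have hza : AnalyticAt ℂ (fun w => a + ψ w) 0 := analyticAt_const.add hψ
    obtain ⟨φ, hφ, hφe, hφ1, hφ2⟩ := exists_lift hn hσ hNq hza
    refine ⟨φ, (isNewtonPuiseuxRoot_iff hf hφ).2 ?_, hφ1, by rw [hφ2, hψ0, add_zero]⟩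
    filter_upwards [hH.pullback_lift hn hza hφe, hψr] with w h1 h2
    rw [h1, h2, mul_zero]
  obtain ⟨φ, hφ, hφ1, hφ2⟩ := hlift a ha
  obtain ⟨φ', hφ', hφ1', hφ2'⟩ := hlift b hb
  have hcoeff : φ'.coeff ((σ : ℚ) / (N * q : ℕ)) ≠ φ.coeff ((σ : ℚ) / (N * q : ℕ)) := by
    rw [hφ2, hφ2']
    simpa using hab.symm
  refine ⟨φ, φ', hφ, hφ', fun he => hcoeff (by rw [he]), ?_⟩
  -- The branch γ itself corresponds to z = 0, where P does not vanish.
  rw [IsGenericOrd, hH.ordAlong_eq (z := fun _ => 0) hf hNq analyticAt_const (by simp)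
    (by rwa [← Polynomial.coeff_zero_eq_eval_zero])]
  filter_upwards [hH.eventually_ordAlong_rhoApprox hf hNq hσ hPne] with g hg
  rw [approx, contactOrder_eq (fun x hx => (hφ1' x hx).trans (hφ1 x hx).symm) hcoeff,
    rhoApprox_congr hφ1, hg]

theorem IsGenericOrd.symm {f : ℂ × ℂ → ℂ} {φ φ' : HahnSeries ℚ ℂ} {q : WithTop ℚ}
    (hne : φ ≠ φ') (h : IsGenericOrd f φ φ' q) : IsGenericOrd f φ' φ q := by
  simpa only [IsGenericOrd, approx_comm hne] using h

/-- Two cofinite sets of constants meet, since ℂ is infinite. -/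
theorem IsGenericOrd.unique {f : ℂ × ℂ → ℂ} {φ φ' : HahnSeries ℚ ℂ} {q q' : WithTop ℚ}
    (h : IsGenericOrd f φ φ' q) (h' : IsGenericOrd f φ φ' q') : q = q' := by
  obtain ⟨g, h1, h2⟩ := (Filter.Eventually.and h h').exists
  exact h1.symm.trans h2

end

end PlaneGerm

theorem theorem3p1 (f : ℂ × ℂ → ℂ) (hf : AnalyticAt ℂ f 0) (hf0 : f 0 = 0)
    (m : ℕ) (hm : PlaneGerm.IsMiniRegularInX f m)
    (r : ℕ) (hr : 2 ≤ r) (ξ : Fin r → HahnSeries ℚ ℂ) (hξ : Function.Injective ξ)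
    (hroots : Set.range ξ = {φ | PlaneGerm.IsNewtonPuiseuxRoot f φ}) :
    (∀ i j : Fin r, i < j → ∃ q : ℚ, PlaneGerm.IsGenericOrd f (ξ i) (ξ j) (q : WithTop ℚ)) ∧
    PlaneGerm.polarQuotients f =
      {q : WithTop ℚ | ∃ i j : Fin r, i < j ∧ PlaneGerm.IsGenericOrd f (ξ i) (ξ j) q} := by
  have hd := PlaneGerm.analyticOrderAt_section_of_isMiniRegularInX hf hm
  have hroot : ∀ i, PlaneGerm.IsNewtonPuiseuxRoot f (ξ i) := fun i => by
    have : ξ i ∈ {φ | PlaneGerm.IsNewtonPuiseuxRoot f φ} := hroots ▸ Set.mem_range_self i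
    exact this
  have hpair : ∀ i j : Fin r, i < j → ∃ q : ℚ,
      PlaneGerm.IsGenericOrd f (ξ i) (ξ j) (q : WithTop ℚ) ∧
        ∃ γ ∈ PlaneGerm.polarBranches f, PlaneGerm.ordAlong f γ = q := fun i j hij =>
    PlaneGerm.exists_polarBranch_of_roots hf hd (hroot i) (hroot j) (hξ.ne hij.ne)
  refine ⟨fun i j hij => (hpair i j hij).imp fun q hq => hq.1, Set.ext fun q => ⟨?_, ?_⟩⟩
  · rintro ⟨γ, hγ, rfl⟩
    obtain ⟨φ, φ', hφ, hφ', hne, hgen⟩ := PlaneGerm.exists_roots_of_polarBranch hf hf0 hd hγ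
    obtain ⟨i, rfl⟩ : φ ∈ Set.range ξ := hroots ▸ hφ
    obtain ⟨j, rfl⟩ : φ' ∈ Set.range ξ := hroots ▸ hφ'
    rcases lt_trichotomy i j with hij | rfl | hij
    · exact ⟨i, j, hij, hgen⟩
    · exact absurd rfl hne
    · exact ⟨j, i, hij, hgen.symm hne⟩
  · rintro ⟨i, j, hij, hq⟩
    obtain ⟨q', hq', γ, hγ, hord⟩ := hpair i j hij
    exact ⟨γ, hγ, (hq.unique hq').trans hord.symm⟩
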